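/- Let $r,k,n$ be integers with $k\ge 5$, $n\ge k$, $3\le r\le \lfloor (k-1)/2\rfloor+1$ and $n\ge k^2/2$, and put $t=\lfloor (k-1)/2\rfloor$. Let $\mathcal H=\{K_r\}\cup\mathcal C_{\ge k}$, where $K_r$ is the complete graph on $r$ vertices and $\mathcal C_{\ge k}$ is the set of all cycles of length at least $k$; a graph is $\mathcal H$-free if it contains no member of $\mathcal H$ as a (not necessarily induced) subgraph. Let $\mathrm{ex}_{2\text{-conn}}(n,\mathcal H)$ be the maximum number of edges in a $2$-connected $\mathcal H$-free graph on $n$ vertices, and let $\mathrm{ex}(m,K_s)$ be the maximum number of edges in a $K_s$-free graph on $m$ vertices. Let $G_2=T(t,r-2)\vee I_{n-t}$ be the join of the Turán graph $T(t,r-2)$ (the balanced complete $(r-2)$-partite graph on $t$ vertices) with an independent set $I_{n-t}$ of $n-t$ vertices. Then $$\mathrm{ex}_{2\text{-conn}}(n,\mathcal H)=e(G_2)=\mathrm{ex}(t,K_{r-1})+t(n-t),$$ where $e(G_2)$ is the number of edges of $G_2$. -/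

import Mathlib

/-- A finite graph is 2-connected if it has at least three vertices, is connected, and stays
connected after the deletion of any single vertex. -/
def IsTwoConnected {V : Type*} (G : SimpleGraph V) : Prop :=
  3 ≤ Nat.card V ∧ G.Connected ∧ ∀ v : V, (G.induce ({v}ᶜ : Set V)).Connected

/-- A family of finite graphs (each with vertex set `Fin m` for some `m`). -/
abbrev GraphFamily : Type := Set (Σ m : ℕ, SimpleGraph (Fin m))

/-- `G` is `F`-free if no member of `F` is contained in `G` as a (not necessarily induced)
subgraph. -/
def FamilyFree (F : GraphFamily) {V : Type*} (G : SimpleGraph V) : Prop :=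
  ∀ H ∈ F, H.2.Free G

/-- The family `𝒞_{≥ k}` of all cycles of length at least `k` (used for `k ≥ 3`). -/
def longCycles (k : ℕ) : GraphFamily :=
  {H | ∃ m : ℕ, k ≤ m ∧ H = ⟨m, SimpleGraph.cycleGraph m⟩}

/-- The family `{K_r, 𝒞_{≥ k}}`. -/
def cliqueAndLongCycles (r k : ℕ) : GraphFamily :=
  insert ⟨r, (⊤ : SimpleGraph (Fin r))⟩ (longCycles k)

/-- The set of the numbers of edges of the 2-connected `F`-free graphs on `n` vertices; its
greatest element is `ex_{2-conn}(n, F)`. -/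
def twoConnEdgeCounts (n : ℕ) (F : GraphFamily) : Set ℕ :=
  {e | ∃ G : SimpleGraph (Fin n), IsTwoConnected G ∧ FamilyFree F G ∧ G.edgeSet.ncard = e}

/-- The join `G ∨ H`: the disjoint union of `G` and `H` together with all edges between them. -/
def graphJoin {V W : Type*} (G : SimpleGraph V) (H : SimpleGraph W) : SimpleGraph (V ⊕ W) :=
  (G ⊕g H) ⊔ completeBipartiteGraph V W

/-- The graph `G₂ = T(t, r - 2) ∨ I_{n - t}` with `t = ⌊(k - 1) / 2⌋`. -/
def graphG2 (n k r : ℕ) : SimpleGraph (Fin ((k - 1) / 2) ⊕ Fin (n - (k - 1) / 2)) :=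
  graphJoin (SimpleGraph.turanGraph ((k - 1) / 2) (r - 2))
    (⊥ : SimpleGraph (Fin (n - (k - 1) / 2)))

/-! Upper bound. Put `t = (k - 1) / 2` and let `C` be a longest cycle, so `|C| ≤ 2t + 1`. Split the
vertices off `C` into the set `W` of those with a neighbour off `C`, and the rest, whose neighbours
all lie on `C`. Since `C` is longest, a vertex of the second kind has at most `|C| / 2`, hence at
most `t`, neighbours.

The edges meeting `W` number at most `(t - 1/2)|W|` (`sum_degIn_outside_le`). One peels off either a
vertex of degree below `t`, or the vertex set of a longest path outside `C` ending next to `C`. If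
all degrees are at least `t`, maximality forces such a path to span a clique with no further
neighbours off `C` in the current set, and its average contribution is again at most `t - 1/2`. The
hard case, where the first vertex has almost all its neighbours on the path, needs two disjoint
exits to `C` (`exists_linkage`) and yields a detour too long for `C` (`exists_long_detour`).

If some vertex `v` of the second kind has exactly `t` neighbours `A` on `C`, then `A` is
`K_{r-1}`-free and `C \ A` spans at most one edge (`exists_only_edge`). That edge is paid for either
by a missing edge to `A` or by `A` being `K_{r-2}`-free, so `C` spans at most `ex(t, K_{r-1}) +
t(|C| - t)` edges, and each vertex off `C` adds at most `t`. Otherwise every vertex off `C` costs at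
most `t - 1/2` on average, and `n ≥ k²/2` makes the total at most `t(n - t)`, even if `C` spans a
clique.

Lower bound. In the join, a cycle never has two consecutive vertices in the independent part, so its
length is at most `2t < k`; a clique takes at most one vertex there.

Degree sums are used throughout instead of edge counts, which keeps the halves integral. -/

/-! ### Longest cycles and detours outside them. -/

section CycleLists

variable {V : Type*} {G : SimpleGraph V}

/-- A nodup list of at least three vertices whose cyclically consecutive members are adjacent. -/
def IsCycleList (G : SimpleGraph V) (l : List V) : Prop :=
  l.Nodup ∧ 3 ≤ l.length ∧ Cycle.Chain G.Adj (l : Cycle V)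

/-- A cycle of maximum length. -/
def IsLongestCycle (G : SimpleGraph V) (C : List V) : Prop :=
  IsCycleList G C ∧ ∀ l, IsCycleList G l → l.length ≤ C.length

theorem isChain_adj_reverse {l : List V} :
    l.reverse.IsChain G.Adj ↔ l.IsChain G.Adj := by
  rw [List.isChain_reverse]
  simp only [G.adj_comm]

theorem isCycleList_cons {x : V} {l : List V} :
    IsCycleList G (x :: l) ↔
      (x :: l).Nodup ∧ 2 ≤ l.length ∧ (x :: (l ++ [x])).IsChain G.Adj := by
  simp [IsCycleList]

theorem IsCycleList.of_isRotated {l l' : List V} (h : IsCycleList G l) (hr : l ~r l') :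
    IsCycleList G l' :=
  ⟨hr.nodup_iff.1 h.1, hr.perm.length_eq ▸ h.2.1, Cycle.coe_eq_coe.2 hr ▸ h.2.2⟩

theorem IsCycleList.reverse {l : List V} (h : IsCycleList G l) : IsCycleList G l.reverse := by
  cases l with
  | nil => simpa using h
  | cons x l =>
    have hr : x :: l.reverse ~r (x :: l).reverse := by
      rw [List.reverse_cons]
      simpa using (List.isRotated_append (l := [x]) (l' := l.reverse))
    refine IsCycleList.of_isRotated ?_ hr
    rw [isCycleList_cons] at h ⊢
    refine ⟨by simpa using h.1, by simpa using h.2.1, ?_⟩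
    have := isChain_adj_reverse.2 h.2.2
    simpa using this

theorem IsLongestCycle.of_isRotated {l l' : List V} (h : IsLongestCycle G l) (hr : l ~r l') :
    IsLongestCycle G l' :=
  ⟨h.1.of_isRotated hr, fun m hm => hr.perm.length_eq ▸ h.2 m hm⟩

theorem IsLongestCycle.reverse {l : List V} (h : IsLongestCycle G l) :
    IsLongestCycle G l.reverse :=
  ⟨h.1.reverse, fun m hm => by simpa using h.2 m hm⟩

theorem exists_isRotated_cons_of_mem {l : List V} {x : V} (hx : x ∈ l) :
    ∃ l', l ~r x :: l' := by
  obtain ⟨s, t, rfl⟩ := List.append_of_mem hx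
  exact ⟨t ++ s, by simpa using List.isRotated_append (l := s) (l' := x :: t)⟩

/-- Replacing the arc `α` by `m` gives another cycle; `m ≠ []` guarantees its three vertices. The
case `α = []` is contradictory, which is how two consecutive vertices of the cycle are shown not to
share a neighbour off it. -/
theorem IsLongestCycle.length_le_arc {x y : V} {α β m : List V}
    (hC : IsLongestCycle G (x :: (α ++ y :: β))) (hm0 : m ≠ [])
    (hm : (x :: (m ++ [y])).IsChain G.Adj) (hnd : m.Nodup)
    (hoff : ∀ z ∈ m, z ∉ x :: (α ++ y :: β)) : m.length ≤ α.length := by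
  have hc := isCycleList_cons.1 hC.1
  have key : IsCycleList G (x :: (m ++ y :: β)) := by
    rw [isCycleList_cons]
    refine ⟨?_, ?_, ?_⟩
    · have h1 := hc.1
      grind
    · have := List.length_pos_iff.2 hm0
      simp; omega
    · have h2 := hc.2.2
      rw [List.append_assoc, List.cons_append, List.isChain_cons_split] at h2 ⊢
      exact ⟨hm, h2.2⟩
  have := hC.2 _ key
  simp at this
  omega

theorem IsLongestCycle.length_le_other_arc {x y : V} {α β m : List V}
    (hC : IsLongestCycle G (x :: (α ++ y :: β))) (hm0 : m ≠ [])
    (hm : (x :: (m ++ [y])).IsChain G.Adj) (hnd : m.Nodup)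
    (hoff : ∀ z ∈ m, z ∉ x :: (α ++ y :: β)) : m.length ≤ β.length := by
  have hr : (x :: (α ++ y :: β)).reverse ~r x :: (β.reverse ++ y :: α.reverse) := by
    simpa using List.isRotated_append (l := β.reverse ++ y :: α.reverse) (l' := [x])
  have := (hC.reverse.of_isRotated hr).length_le_arc hm0 hm hnd (by
    intro z hz; have := hoff z hz; grind)
  simpa using this

/-- Two distinct vertices of a longest cycle joined by a path outside the cycle are far apart. -/
theorem IsLongestCycle.two_mul_length_le {C m : List V} {x y : V}
    (hC : IsLongestCycle G C) (hx : x ∈ C) (hy : y ∈ C) (hxy : x ≠ y) (hm0 : m ≠ [])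
    (hm : (x :: (m ++ [y])).IsChain G.Adj) (hnd : m.Nodup)
    (hoff : ∀ z ∈ m, z ∉ C) : 2 * (m.length + 1) ≤ C.length := by
  obtain ⟨γ, hγ⟩ := exists_isRotated_cons_of_mem hx
  have hyγ : y ∈ γ := by
    have := hγ.mem_iff.1 hy
    grind
  obtain ⟨α, β, rfl⟩ := List.append_of_mem hyγ
  have hoff' : ∀ z ∈ m, z ∉ x :: (α ++ y :: β) := fun z hz h => hoff z hz (hγ.mem_iff.2 h)
  have h1 := (hC.of_isRotated hγ).length_le_arc hm0 hm hnd hoff'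
  have h2 := (hC.of_isRotated hγ).length_le_other_arc hm0 hm hnd hoff'
  have := hγ.perm.length_eq
  simp at this
  omega

theorem two_mul_countP_le {α : Type*} (p : α → Bool) : ∀ l : List α,
    l.IsChain (fun a b => ¬ (p a ∧ p b)) → 2 * l.countP p ≤ l.length + 1
  | [] => by simp
  | [a] => by
      intro _
      have := List.countP_le_length (p := p) (l := [a])
      rw [List.length_singleton] at *
      omega
  | a :: b :: l => by
      intro h
      rw [List.isChain_cons_cons] at h
      have h1 := two_mul_countP_le p (b :: l) h.2
      have h2 := two_mul_countP_le p l h.2.tail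
      simp only [List.countP_cons, List.length_cons] at *
      grind

/-- The first `k` and last `k` places carry no marked element, and at most half (rounded up) of the
middle is marked. A marked element must exist so that the two end blocks do not overlap. -/
theorem two_mul_countP_add_le {α : Type*} (p : α → Bool) (l : List α) (k : ℕ)
    (hch : l.IsChain (fun a b => ¬ (p a ∧ p b)))
    (hk : ∀ s z t, l = s ++ z :: t → p z → k ≤ s.length ∧ k ≤ t.length)
    (hex : ∃ z ∈ l, p z) : 2 * (l.countP p + k) ≤ l.length + 1 := by
  obtain ⟨z, hz, hpz⟩ := hex
  have hlen : 2 * k + 1 ≤ l.length := by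
    obtain ⟨s, t, rfl⟩ := List.append_of_mem hz
    have := hk s z t rfl hpz
    simp; omega
  obtain ⟨a, b, d, rfl, ha, hd⟩ : ∃ a b d, l = a ++ (b ++ d) ∧ a.length = k ∧ d.length = k := by
    refine ⟨l.take k, (l.drop k).take (l.length - 2 * k), (l.drop k).drop (l.length - 2 * k),
      by simp, by simp; omega, by simp; omega⟩
  have h1 : a.countP p = 0 := by
    rw [List.countP_eq_zero]
    intro x hx hpx
    obtain ⟨s, t, rfl⟩ := List.append_of_mem hx
    have := (hk s x (t ++ (b ++ d)) (by simp) hpx).1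
    simp at ha; omega
  have h2 : d.countP p = 0 := by
    rw [List.countP_eq_zero]
    intro x hx hpx
    obtain ⟨s, t, rfl⟩ := List.append_of_mem hx
    have := (hk (a ++ (b ++ s)) x t (by simp) hpx).2
    simp at hd; omega
  have h3 := two_mul_countP_le p b hch.right_of_append.left_of_append
  simp only [List.countP_append, List.length_append] at *
  omega

open Classical in
/-- If a path `l` outside a longest cycle `C` ends next to `y ∈ C`, then the other neighbours on `C`
of the first vertex of `l` are far from `y`, and pairwise non-consecutive. -/
theorem IsLongestCycle.two_mul_length_add_card_le {C l : List V} {v y : V}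
    (hC : IsLongestCycle G C) (hy : y ∈ C) (hl : (v :: l).Nodup)
    (hch : (v :: (l ++ [y])).IsChain G.Adj) (hoff : ∀ z ∈ v :: l, z ∉ C)
    (hX : ((C.toFinset.filter (G.Adj v)).erase y).Nonempty) :
    2 * ((v :: l).length + ((C.toFinset.filter (G.Adj v)).erase y).card) ≤ C.length := by
  obtain ⟨γ, hγ⟩ := exists_isRotated_cons_of_mem hy
  have hC' := hC.of_isRotated hγ
  have hoff' : ∀ z ∈ v :: l, z ∉ y :: γ := fun z hz h => hoff z hz (hγ.mem_iff.2 h)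
  have hnd := hC'.1.1
  have hX' : (C.toFinset.filter (G.Adj v)).erase y = (γ.filter (G.Adj v)).toFinset := by
    ext z
    have : z ∈ C ↔ z ∈ y :: γ := hγ.mem_iff
    simp only [Finset.mem_erase, Finset.mem_filter, List.mem_toFinset, this, List.mem_filter,
      decide_eq_true_eq]
    grind
  have hcard : ((C.toFinset.filter (G.Adj v)).erase y).card = γ.countP (G.Adj v) := by
    rw [hX', List.toFinset_card_of_nodup (hnd.of_cons.filter _), List.countP_eq_length_filter]
  rw [hcard, add_comm, hγ.perm.length_eq, List.length_cons (as := γ)]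
  -- The cycle is cut open at `y`, leaving `γ` with `γ.length + 1 = C.length`. Neighbours of `v` are
  -- not consecutive, and the detour through `v :: l` to `y` keeps each of them at least `(v ::
  -- l).length` places from both ends of `γ`.
  apply two_mul_countP_add_le
  · rw [List.isChain_iff_forall_rel_of_append_cons_cons]
    rintro a b s t rfl ⟨ha, hb⟩
    have hr : y :: (s ++ a :: b :: t) ~r a :: ([] ++ b :: (t ++ y :: s)) := by
      simpa using List.isRotated_append (l := y :: s) (l' := a :: b :: t)
    have := (hC'.of_isRotated hr).length_le_arc (m := [v]) (by simp)
      (by simp at ha hb; simp [ha.symm, hb]) (by simp)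
      (by
        intro z hz h
        simp only [List.mem_singleton] at hz
        exact hoff' z (by simp [hz]) (hr.mem_iff.2 h))
    simp at this
  · rintro s z t rfl hz
    simp at hz
    have hch' : (y :: ((v :: l).reverse ++ [z])).IsChain G.Adj := by
      rw [← isChain_adj_reverse]
      simp only [List.reverse_cons, List.reverse_append, List.reverse_reverse, List.reverse_nil,
        List.nil_append, List.cons_append, List.isChain_cons_cons]
      exact ⟨hz.symm, hch⟩
    have hoff2 : ∀ w ∈ (v :: l).reverse, w ∉ y :: (s ++ z :: t) := fun w hw =>
      hoff' w (List.mem_reverse.1 hw)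
    have h1 := hC'.length_le_arc (by simp) hch' (List.nodup_reverse.2 hl) hoff2
    have h2 := hC'.length_le_other_arc (by simp) hch' (List.nodup_reverse.2 hl) hoff2
    rw [List.length_reverse] at h1 h2
    exact ⟨h1, h2⟩
  · obtain ⟨z, hz⟩ := hX
    rw [hX'] at hz
    simp at hz
    exact ⟨z, hz.1, by simpa using hz.2⟩

end CycleLists

/-! ### Two disjoint paths in a 2-connected graph. -/

section Linkage

variable {V : Type*} {G : SimpleGraph V}

theorem exists_first_mem {C : Set V} : ∀ {l : List V}, (∃ z ∈ l, z ∈ C) →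
    ∃ s z t, l = s ++ z :: t ∧ z ∈ C ∧ ∀ x ∈ s, x ∉ C
  | [], h => by simp at h
  | a :: l, h => by
    by_cases ha : a ∈ C
    · exact ⟨[], a, l, rfl, ha, by simp⟩
    · obtain ⟨s, z, t, rfl, hz, hs⟩ := exists_first_mem (l := l) (C := C) (by
        obtain ⟨z, hz, hzC⟩ := h
        rcases List.mem_cons.1 hz with rfl | hz
        · exact absurd hzC ha
        · exact ⟨z, hz, hzC⟩)
      refine ⟨a :: s, z, t, rfl, hz, ?_⟩
      simpa [ha] using hs

theorem exists_last_mem {C : Set V} {l : List V} (h : ∃ z ∈ l, z ∈ C) :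
    ∃ s z t, l = s ++ z :: t ∧ z ∈ C ∧ ∀ x ∈ t, x ∉ C := by
  obtain ⟨s, z, t, hl, hz, hs⟩ := exists_first_mem (C := C) (l := l.reverse) (by simpa using h)
  refine ⟨t.reverse, z, s.reverse, ?_, hz, by simpa using hs⟩
  have := congrArg List.reverse hl
  simpa using this

/-- A shortest path from `A` to `B` in `G - v` meets each set only at its end. The double form `x ::
m = m' ++ [y]` exposes both ends and still allows a single vertex. -/
theorem IsTwoConnected.exists_path (h : IsTwoConnected G) {A B : Set V} {a b v : V}
    (ha : a ∈ A) (hb : b ∈ B) (hav : a ≠ v) (hbv : b ≠ v) :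
    ∃ x m m' y, x :: m = m' ++ [y] ∧ (x :: m).Nodup ∧ (x :: m).IsChain G.Adj ∧ v ∉ x :: m ∧
      x ∈ A ∧ (∀ z ∈ m, z ∉ A) ∧ y ∈ B ∧ ∀ z ∈ m', z ∉ B := by
  let P : List V → Prop := fun l => l.Nodup ∧ l.IsChain G.Adj ∧ v ∉ l ∧
    (∃ x ∈ A, ∃ m, l = x :: m) ∧ (∃ y ∈ B, ∃ m, l = m ++ [y])
  classical
  have hex : ∃ n, ∃ l, P l ∧ l.length = n := by
    obtain ⟨p, hp⟩ := (((h.2.2 v).preconnected ⟨a, hav⟩ ⟨b, hbv⟩).some).toPath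
    refine ⟨_, p.support.map Subtype.val, ⟨?_, ?_, ?_, ?_, ?_⟩, rfl⟩
    · exact hp.support_nodup.map Subtype.val_injective
    · rw [List.isChain_map]
      exact p.isChain_adj_support.imp fun _ _ h => h
    · simp
    · exact ⟨a, ha, p.support.tail.map Subtype.val, by
        rw [← List.map_cons (f := Subtype.val) (a := (⟨a, hav⟩ : ({v}ᶜ : Set V))),
          SimpleGraph.Walk.cons_tail_support]⟩
    · exact ⟨b, hb, p.support.dropLast.map Subtype.val, by
        have e := List.dropLast_append_getLast p.support_ne_nil
        rw [SimpleGraph.Walk.getLast_support] at e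
        exact (congrArg (List.map Subtype.val) e.symm).trans List.map_append⟩
  obtain ⟨l, hl, hlen⟩ := Nat.find_spec hex
  have hmin : ∀ l', P l' → l.length ≤ l'.length := fun l' hl' =>
    hlen ▸ Nat.find_min' hex ⟨l', hl', rfl⟩
  obtain ⟨hnd, hch, hv, ⟨x, hx, m, rfl⟩, y, hy, m', hm'⟩ := hl
  refine ⟨x, m, m', y, hm', hnd, hch, hv, hx, ?_, hy, ?_⟩
  · intro z hz hzA
    obtain ⟨s, t, rfl⟩ := List.append_of_mem hz
    have := hmin (z :: t) ⟨hnd.of_cons.of_append_right, hch.tail.right_of_append, by grind,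
      ⟨z, hzA, t, rfl⟩, y, hy, by
        rcases List.eq_nil_or_concat t with rfl | ⟨t', w, rfl⟩
        · have : x :: s ++ [z] = m' ++ [y] := by simpa using hm'
          have := (List.append_inj' this rfl).2
          exact ⟨[], by simpa using this⟩
        · have : x :: (s ++ z :: t') ++ [w] = m' ++ [y] := by simpa using hm'
          have := (List.append_inj' this rfl).2
          simp only [List.cons.injEq, and_true] at this
          exact ⟨z :: t', by simp [this]⟩⟩
    simp at this
    omega
  · intro z hz hzB
    rw [hm'] at hnd hch hv hmin
    obtain ⟨s, t, rfl⟩ := List.append_of_mem hz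
    have := hmin (s ++ [z]) ⟨by grind, by
      rw [List.append_assoc, List.cons_append, List.isChain_split] at hch
      exact hch.1, by grind,
      ⟨x, hx, by
        cases s with
        | nil =>
          have h1 : x = z := by simp at hm'; exact hm'.1
          exact ⟨[], by simp [h1]⟩
        | cons s0 s =>
          have h1 : x = s0 := by simp at hm'; exact hm'.1
          exact ⟨s ++ [z], by simp [h1]⟩⟩,
      z, hzB, s, rfl⟩
    simp at this

theorem exists_mem_getLast?_of_suffix {C : Set V} {p q : List V} {x : V}
    (h : ∃ y ∈ C, y ∈ (p ++ x :: q).getLast?) : ∃ y ∈ C, y ∈ (x :: q).getLast? := by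
  simpa using h

/-- In a 2-connected graph, given a path `R` avoiding `T` to a set `C` with at least two members,
there are two disjoint paths to `C`, one from the first vertex of `R` and one from `T`. -/
theorem IsTwoConnected.exists_linkage (h : IsTwoConnected G) {T C : Set V} (hT : T.Nonempty)
    (hC : C.Nontrivial) : ∀ (R : List V) (r : V), (r :: R).IsChain G.Adj →
    (∃ y ∈ C, y ∈ (r :: R).getLast?) → (∀ z ∈ r :: R, z ∉ T) →
    ∃ s t τ, (r :: s).Nodup ∧ (r :: s).IsChain G.Adj ∧ (∃ z ∈ C, z ∈ (r :: s).getLast?) ∧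
      (∀ z ∈ r :: s, z ∉ T) ∧ (τ :: t).Nodup ∧ (τ :: t).IsChain G.Adj ∧
      (∃ z ∈ C, z ∈ (τ :: t).getLast?) ∧
      τ ∈ T ∧ (∀ z ∈ t, z ∉ T) ∧ ∀ z ∈ r :: s, z ∉ τ :: t
  | [], r, _, hlast, hRT => by
    have hr : r ∈ C := by simpa using hlast
    obtain ⟨y, hy, hyr⟩ := hC.exists_ne r
    obtain ⟨τ₀, hτ₀⟩ := hT
    have hne : τ₀ ≠ r := fun e => hRT r (by simp) (e ▸ hτ₀)
    obtain ⟨x, m, m', w, hm, hnd, hch, hv, hx, hmA, hw, -⟩ := h.exists_path hτ₀ hy hne hyr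
    refine ⟨[], m, x, by simp, by simp, ⟨r, hr, by simp⟩, hRT, hnd, hch, ⟨w, hw, ?_⟩, hx, hmA, ?_⟩
    · rw [hm]; simp
    · intro z hz; simp at hz; exact hz ▸ hv
  | r :: R, r', hch, hlast, hRT => by
    rw [List.isChain_cons_cons] at hch
    obtain ⟨s, t, τ, hs, hsch, hsC, hsT, ht, htch, htC, hτ, htT, hdis⟩ :=
      h.exists_linkage hT hC R r hch.2 (by simpa using hlast)
        (fun z hz => hRT z (List.mem_cons_of_mem _ hz))
    have hr'T : r' ∉ T := hRT r' (by simp)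
    -- Moving the start back from `r` to `r'` is harmless if `r'` is on the first path (take a
    -- suffix) or on neither (prepend it). Only `r'` on the path from `T` needs rerouting.
    by_cases h1 : r' ∈ r :: s
    · obtain ⟨p, q, hpq⟩ := List.append_of_mem h1
      rw [hpq] at hs hsch hsC
      refine ⟨q, t, τ, hs.of_append_right, hsch.right_of_append, exists_mem_getLast?_of_suffix hsC,
        ?_, ht, htch, htC, hτ, htT, ?_⟩
      · intro z hz; exact hsT z (by rw [hpq]; exact List.mem_append_right _ hz)
      · intro z hz; exact hdis z (by rw [hpq]; exact List.mem_append_right _ hz)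
    have hr's : (r' :: r :: s).Nodup := List.nodup_cons.2 ⟨h1, hs⟩
    have hr'ch : (r' :: r :: s).IsChain G.Adj := List.isChain_cons_cons.2 ⟨hch.1, hsch⟩
    have hr'C : ∃ z ∈ C, z ∈ (r' :: r :: s).getLast? := by simpa using hsC
    have hr'sT : ∀ z ∈ r' :: r :: s, z ∉ T := List.forall_mem_cons.2 ⟨hr'T, hsT⟩
    by_cases h2 : r' ∈ τ :: t
    · have hτr' : τ ≠ r' := fun e => hr'T (e ▸ hτ)
      obtain ⟨pf, q, rfl⟩ := List.append_of_mem (List.mem_of_ne_of_mem hτr'.symm h2)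
      rw [← List.cons_append] at ht htch hdis htC
      have htq := List.nodup_append'.1 ht
      have hpfq : ∀ z ∈ τ :: pf, z ∉ r' :: q := htq.2.2
      -- Here `r'` cuts the path from `T` into `τ :: pf` and `r' :: q`. A path avoiding `r'` bridges
      -- from `T` or `pf` to `C` or one of the two tails `r :: s` and `q`.
      obtain ⟨x, m, m', y, hm, hnd, hZch, hv, hx, hmA, hy, hmB⟩ :=
        h.exists_path (A := T ∪ {z | z ∈ τ :: pf}) (B := C ∪ ({z | z ∈ r :: s} ∪ {z | z ∈ q}))
          (a := τ) (b := r) (v := r') (Or.inl hτ) (Or.inr (Or.inl (by simp))) hτr' hch.1.ne'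
      obtain ⟨p, τ', t', hp, hτ', ht'T, hpnd, hpch, hpsub⟩ : ∃ p τ' t', p ++ [x] = τ' :: t' ∧
          τ' ∈ T ∧ (∀ z ∈ t', z ∉ T) ∧ (p ++ [x]).Nodup ∧ (p ++ [x]).IsChain G.Adj ∧
          ∀ z ∈ p, z ∈ τ :: pf := by
        by_cases hxT : x ∈ T
        · exact ⟨[], x, [], rfl, hxT, by simp, by simp, by simp, by simp⟩
        · have hxpf : x ∈ pf := by
            rcases hx with hx | hx
            · exact absurd hx hxT
            · exact List.mem_of_ne_of_mem (fun e => hxT (e ▸ hτ)) hx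
          obtain ⟨a, b, rfl⟩ := List.append_of_mem hxpf
          have e : τ :: (a ++ x :: b) ++ r' :: q = (τ :: a ++ [x]) ++ (b ++ r' :: q) := by simp
          rw [e] at ht htch
          refine ⟨τ :: a, τ, a ++ [x], rfl, hτ, ?_, ht.of_append_left, htch.left_of_append, ?_⟩
          · intro z hz
            exact htT z (by simp only [List.mem_append, List.mem_cons] at hz ⊢; grind)
          · intro z hz
            simp only [List.mem_append, List.mem_cons] at hz ⊢; grind
      -- After the bridge, the path from `T` continues from `y` along the tail it hit (`q'`), and
      -- `r'` takes the other tail (`u`). If `y` is on neither, then `y ∈ C` and the path stops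
      -- there.
      obtain ⟨q', u, hq'nd, hq'ch, hq'C, hq'B, hq'T, hq'pf, hund, huch, huC, huT, hupf, huq', huy,
          huB⟩ :
          ∃ q' u, (y :: q').Nodup ∧ (y :: q').IsChain G.Adj ∧
            (∃ z ∈ C, z ∈ (y :: q').getLast?) ∧ (∀ z ∈ q', z ∈ r :: s ∨ z ∈ q) ∧
            (∀ z ∈ q', z ∉ T) ∧ (∀ z ∈ q', z ∉ τ :: pf) ∧ (r' :: u).Nodup ∧
            (r' :: u).IsChain G.Adj ∧ (∃ z ∈ C, z ∈ (r' :: u).getLast?) ∧ (∀ z ∈ r' :: u, z ∉ T) ∧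
            (∀ z ∈ r' :: u, z ∉ τ :: pf) ∧ (∀ z ∈ r' :: u, z ∉ q') ∧ y ∉ u ∧
            ∀ z ∈ u, z ∈ r :: s ∨ z ∈ q := by
        by_cases hys : y ∈ r :: s
        · obtain ⟨a, b, hab⟩ := List.append_of_mem hys
          rw [hab] at hs hsch hsC
          have hb : ∀ z ∈ b, z ∈ r :: s := fun z hz => by rw [hab]; simp [hz]
          refine ⟨b, q, hs.of_append_right, hsch.right_of_append,
            exists_mem_getLast?_of_suffix hsC, fun z hz => Or.inl (hb z hz),
            fun z hz => hsT z (hb z hz),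
            fun z hz hz' => hdis z (hb z hz) (List.mem_append_left _ hz'), htq.2.1,
            htch.right_of_append, exists_mem_getLast?_of_suffix htC, ?_,
            fun z hz hz' => hpfq z hz' hz, ?_, ?_, fun z hz => Or.inr hz⟩
          · intro z hz; exact htT z (List.mem_append_right _ hz)
          · intro z hz hz'; exact hdis z (hb z hz') (List.mem_append_right _ hz)
          · intro hz
            exact hdis y hys (List.mem_append_right _ (List.mem_cons_of_mem _ hz))
        · by_cases hyq : y ∈ q
          · obtain ⟨a, b, rfl⟩ := List.append_of_mem hyq
            have e : τ :: pf ++ r' :: (a ++ y :: b) = (τ :: pf ++ r' :: a) ++ (y :: b) := by simp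
            have hb : ∀ z ∈ b, z ∈ r' :: (a ++ y :: b) := fun z hz => by simp [hz]
            have hb' : ∀ z ∈ b, z ∉ r :: s := fun z hz hz' =>
              hdis z hz' (List.mem_append_right _ (hb z hz))
            have hr'b : r' ∉ b := fun hz => (List.nodup_cons.1 htq.2.1).1 (by simp [hz])
            refine ⟨b, r :: s, ?_, ?_, ?_, ?_, ?_, ?_, hr's, hr'ch, hr'C, hr'sT, ?_, ?_, hys,
              fun z hz => Or.inl hz⟩
            · rw [e] at ht; exact ht.of_append_right
            · rw [e] at htch; exact htch.right_of_append
            · rw [e] at htC; exact exists_mem_getLast?_of_suffix htC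
            · intro z hz; right; simp [hz]
            · intro z hz; exact htT z (List.mem_append_right _ (hb z hz))
            · intro z hz hz'; exact hpfq z hz' (hb z hz)
            · refine List.forall_mem_cons.2 ⟨fun hz => hpfq _ hz (by simp), fun z hz hz' => ?_⟩
              exact hdis z hz (List.mem_append_left _ hz')
            · exact List.forall_mem_cons.2 ⟨hr'b, fun z hz hz' => hb' z hz' hz⟩
          · have hyC : y ∈ C := by
              rcases hy with hy | hy | hy
              · exact hy
              · exact absurd hy hys
              · exact absurd hy hyq
            refine ⟨[], r :: s, by simp, by simp, ⟨y, hyC, by simp⟩, by simp, by simp, by simp,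
              hr's, hr'ch, hr'C, hr'sT, ?_, by simp, hys, fun z hz => Or.inl hz⟩
            refine List.forall_mem_cons.2 ⟨fun hz => hpfq _ hz (by simp), fun z hz hz' => ?_⟩
            exact hdis z hz (List.mem_append_left _ hz')
      have e1 : τ' :: (t' ++ (m ++ q')) = p ++ (x :: m ++ q') := by
        have : p ++ (x :: m ++ q') = p ++ [x] ++ (m ++ q') := by simp
        rw [this, hp]; simp
      have e2 : x :: m ++ q' = m' ++ y :: q' := by rw [hm]; simp
      have hBm' : ∀ z ∈ m', ¬ (z ∈ r :: s ∨ z ∈ q) := fun z hz h => hmB z hz (Or.inr h)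
      have hZq' : ∀ z ∈ x :: m, z ∉ q' := by
        intro z hz hz'
        rw [hm, List.mem_append, List.mem_singleton] at hz
        rcases hz with hz | rfl
        · exact hBm' z hz (hq'B z hz')
        · exact (List.nodup_cons.1 hq'nd).1 hz'
      refine ⟨u, t' ++ (m ++ q'), τ', hund, huch, huC, huT, ?_, ?_, ?_, hτ', ?_, ?_⟩
      · rw [e1, List.nodup_append']
        refine ⟨hpnd.of_append_left, List.nodup_append'.2 ⟨hnd, hq'nd.of_cons, hZq'⟩, ?_⟩
        intro z hz hz'
        rw [List.mem_append, List.mem_cons] at hz'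
        rcases hz' with (rfl | hz') | hz'
        · exact (List.nodup_append'.1 hpnd).2.2 hz (by simp)
        · exact hmA z hz' (Or.inr (hpsub z hz))
        · exact hq'pf z hz' (hpsub z hz)
      · rw [e1, List.cons_append, List.isChain_split]
        refine ⟨hpch, ?_⟩
        rw [← List.cons_append, e2, List.isChain_split]
        exact ⟨hm ▸ hZch, hq'ch⟩
      · rw [e1, e2]
        simpa using hq'C
      · intro z hz
        simp only [List.mem_append] at hz
        rcases hz with hz | hz | hz
        · exact ht'T z hz
        · exact fun h => hmA z hz (Or.inl h)
        · exact hq'T z hz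
      · intro z hz hz'
        rw [e1, List.mem_append, List.mem_append] at hz'
        rcases hz' with hz' | hz' | hz'
        · exact hupf z hz (hpsub z hz')
        · rcases List.mem_cons.1 hz with rfl | hzu
          · exact hv hz'
          · rw [hm, List.mem_append, List.mem_singleton] at hz'
            rcases hz' with hz' | rfl
            · exact hBm' z hz' (huB z hzu)
            · exact huy hzu
        · exact huq' z hz hz'
    · exact ⟨r :: s, t, τ, hr's, hr'ch, hr'C, hr'sT, ht, htch, htC, hτ, htT,
        List.forall_mem_cons.2 ⟨h2, hdis⟩⟩

theorem exists_prefix_to_first_mem {C : Set V} {l : List V} {x : V} (hx : x ∉ C)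
    (h : ∃ z ∈ C, z ∈ (x :: l).getLast?) :
    ∃ s z t, l = s ++ z :: t ∧ z ∈ C ∧ ∀ w ∈ s, w ∉ C := by
  obtain ⟨z, hz, hzl⟩ := h
  have hmem : z ∈ x :: l := List.mem_of_getLast? hzl
  exact exists_first_mem ⟨z, List.mem_of_ne_of_mem (fun e : z = x => hx (e ▸ hz)) hmem, hz⟩

/-- Two disjoint exits to `C` from a path `pre ++ q₀ :: rest` outside `C` that ends next to `C`:
one from `q₀`, and one from a vertex of `pre`. -/
theorem IsTwoConnected.exists_two_exits (h : IsTwoConnected G) {C : Set V} (hC : C.Nontrivial)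
    {pre rest : List V} {q₀ y : V} (hpre : pre ≠ []) (hy : y ∈ C)
    (hch : (q₀ :: (rest ++ [y])).IsChain G.Adj) (hnd : (pre ++ q₀ :: rest).Nodup)
    (hoff : ∀ z ∈ pre ++ q₀ :: rest, z ∉ C) :
    ∃ v a b x₁ x₂, v ∈ pre ∧ x₁ ∈ C ∧ x₂ ∈ C ∧ x₁ ≠ x₂ ∧ (x₁ :: (a ++ [v])).IsChain G.Adj ∧
      (q₀ :: (b ++ [x₂])).IsChain G.Adj ∧ a.Nodup ∧ b.Nodup ∧ (∀ z ∈ a, z ∉ b) ∧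
      (∀ z ∈ a, z ∉ C) ∧ (∀ z ∈ b, z ∉ C) ∧ (∀ z ∈ a, z ∉ pre ++ [q₀]) ∧
      ∀ z ∈ b, z ∉ pre ++ [q₀] := by
  have hdisj := (List.nodup_append'.1 hnd).2.2
  obtain ⟨s, t, τ, hs, hsch, hsC, hsT, ht, htch, htC, hτ, htT, hdis⟩ :=
    h.exists_linkage (T := {z | z ∈ pre}) (C := C) ⟨pre.head hpre, List.head_mem hpre⟩ hC
      (rest ++ [y]) q₀ hch ⟨y, hy, by rw [← List.cons_append, List.getLast?_append]; simp⟩ (by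
        intro z hz hzp
        have hz' : z ∈ q₀ :: rest ∨ z = y := by simpa [or_assoc] using hz
        rcases hz' with hz' | rfl
        · exact hdisj hzp hz'
        · exact hoff z (List.mem_append_left _ hzp) hy)
  obtain ⟨b, x₂, b', rfl, hx₂, hb⟩ := exists_prefix_to_first_mem
    (hoff q₀ (by simp)) hsC
  obtain ⟨a, x₁, a', rfl, hx₁, ha⟩ := exists_prefix_to_first_mem
    (hoff τ (List.mem_append_left _ hτ)) htC
  have hs' := List.nodup_append'.1 hs.of_cons
  have ht' := List.nodup_append'.1 ht.of_cons
  refine ⟨τ, a.reverse, b, x₁, x₂, hτ, hx₁, hx₂, ?_, ?_, ?_, by simpa using ht'.1, hs'.1, ?_, ?_, hb,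
    ?_, ?_⟩
  · rintro rfl
    exact hdis x₁ (by simp) (by simp)
  · rw [← isChain_adj_reverse]
    simpa using (List.isChain_cons_split.1 htch).1
  · exact (List.isChain_cons_split.1 hsch).1
  · intro z hz hz'
    exact hdis z (by simp [hz']) (by simp [List.mem_reverse.1 hz])
  · intro z hz; exact ha z (List.mem_reverse.1 hz)
  · intro z hz hz'
    rw [List.mem_reverse] at hz
    rw [List.mem_append, List.mem_singleton] at hz'
    rcases hz' with hz' | rfl
    · exact htT z (by simp [hz]) hz'
    · exact hdis z (by simp) (by simp [hz])
  · intro z hz hz'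
    rw [List.mem_append, List.mem_singleton] at hz'
    rcases hz' with hz' | rfl
    · exact hsT z (by simp [hz]) hz'
    · exact (List.nodup_cons.1 hs).1 (by simp [hz])

end Linkage

/-! ### Degrees into a vertex set. -/

section EdgeCounting

variable {V : Type*} (G : SimpleGraph V)

open Classical in
/-- The number of neighbours of `v` in `S`. -/
noncomputable def degIn (v : V) (S : Finset V) : ℕ := (S.filter (G.Adj v)).card

variable {G}

theorem degIn_union {S T : Finset V} [DecidableEq V] (h : Disjoint S T) (v : V) :
    degIn G v (S ∪ T) = degIn G v S + degIn G v T := by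
  classical
  unfold degIn
  rw [Finset.filter_union, Finset.card_union_of_disjoint (Finset.disjoint_filter_filter h)]

theorem degIn_sdiff_add {S D : Finset V} [DecidableEq V] (h : S ⊆ D) (v : V) :
    degIn G v S + degIn G v (D \ S) = degIn G v D := by
  rw [← degIn_union Finset.disjoint_sdiff, Finset.union_sdiff_of_subset h]

theorem degIn_mono {S T : Finset V} (h : S ⊆ T) (v : V) : degIn G v S ≤ degIn G v T := by
  classical
  exact Finset.card_le_card (Finset.filter_subset_filter _ h)

theorem degIn_le_card (v : V) (S : Finset V) : degIn G v S ≤ S.card := by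
  classical
  exact Finset.card_filter_le _ _

theorem degIn_eq_zero {v : V} {S : Finset V} : degIn G v S = 0 ↔ ∀ w ∈ S, ¬ G.Adj v w := by
  classical
  simp [degIn, Finset.filter_eq_empty_iff]

theorem sum_degIn_comm (S T : Finset V) :
    ∑ v ∈ S, degIn G v T = ∑ w ∈ T, degIn G w S := by
  classical
  simp only [degIn, Finset.card_filter]
  rw [Finset.sum_comm]
  simp only [G.adj_comm]

end EdgeCounting

/-! ### Edges meeting the nontrivial components outside a longest cycle. -/

section Outside

variable {V : Type*} {G : SimpleGraph V}

/-- The path `v :: l` avoids `C`, starts in `D` and ends next to `y ∈ C`. -/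
structure IsAccessPath (G : SimpleGraph V) (C : List V) (D : Finset V) (v : V) (l : List V)
    (y : V) : Prop where
  mem : v ∈ D
  exit : y ∈ C
  nodup : (v :: l).Nodup
  chain : (v :: (l ++ [y])).IsChain G.Adj
  off : ∀ z ∈ v :: l, z ∉ C

theorem IsLongestCycle.nontrivial {C : List V} (hC : IsLongestCycle G C) :
    {z | z ∈ C}.Nontrivial := by
  obtain ⟨hnd, h3, -⟩ := hC.1
  match C, h3, hnd with
  | x :: y :: l, _, hnd => exact ⟨x, by simp, y, by simp, by grind⟩

/-- If the first vertex of an access path has `d ≥ 1` neighbours in `D`, all of them on the path,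
then there is a path between two vertices of `C` with at least `d + 1` interior vertices. -/
theorem IsAccessPath.exists_long_detour (h2 : IsTwoConnected G) {C l : List V} {D : Finset V}
    {v y : V} (hC : IsLongestCycle G C) (hp : IsAccessPath G C D v l y)
    (hN : ∀ z ∈ D, G.Adj v z → z ∈ l) (hd : 1 ≤ degIn G v D) :
    2 * (degIn G v D + 2) ≤ C.length := by
  classical
  have hex : ∃ z ∈ l, z ∈ {z | z ∈ D ∧ G.Adj v z} := by
    obtain ⟨z, hz⟩ := Finset.card_pos.1 (show 0 < _ from hd)
    rw [Finset.mem_filter] at hz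
    exact ⟨z, hN z hz.1 hz.2, hz⟩
  -- The last neighbour `q₀` of `v` in `D` is chosen so that `v :: s ++ [q₀]` contains all of them.
  -- One exit will start at `q₀` and the other at some `w` in `v :: s`.
  obtain ⟨s, q₀, rest, rfl, hq₀, hrest⟩ := exists_last_mem hex
  have hnd := hp.nodup
  have hch := hp.chain
  have e : v :: (s ++ q₀ :: rest ++ [y]) = (v :: s) ++ (q₀ :: (rest ++ [y])) := by simp
  rw [e] at hch
  obtain ⟨w, a, b, x₁, x₂, hw, hx₁, hx₂, hne, hach, hbch, hand, hbnd, hab, haC, hbC, ha, hb⟩ :=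
    h2.exists_two_exits (pre := v :: s) (rest := rest) (q₀ := q₀) hC.nontrivial (by simp)
      hp.exit hch.right_of_append hnd hp.off
  obtain ⟨α, β, hαβ⟩ := List.append_of_mem hw
  obtain ⟨β₁, w', β₂, hβ, hw', hβ₁⟩ := exists_first_mem (l := β ++ [q₀]) (C := {z | G.Adj v z})
    ⟨q₀, by simp, hq₀.2⟩
  obtain ⟨γ, hγ⟩ : ∃ γ, α ++ [w] = v :: γ := by
    cases α with
    | nil => simp at hαβ; exact ⟨[], by simp [hαβ.1]⟩
    | cons a₀ α => simp at hαβ; exact ⟨α ++ [w], by simp [hαβ.1]⟩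
  have hsplit : v :: s ++ [q₀] = (α ++ [w]) ++ (β₁ ++ w' :: β₂) := by
    rw [hαβ, ← hβ]; simp
  have hnd' : (v :: s ++ [q₀]).Nodup := by
    have : v :: (s ++ q₀ :: rest) = (v :: s ++ [q₀]) ++ rest := by simp
    rw [this] at hnd
    exact hnd.of_append_left
  have hch' : (v :: s ++ [q₀]).IsChain G.Adj := (List.isChain_split.1 hch).1
  -- From `w` go back to `v`, jump to the first neighbour `w'` of `v` after `w`, and go on to `q₀`.
  -- The skipped vertices `β₁` are not neighbours of `v`, so `M` contains `v` and all its neighbours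
  -- in `D`.
  set M := (α ++ [w]).reverse ++ w' :: β₂ with hM
  have hMsub : ∀ z ∈ M, z ∈ v :: s ++ [q₀] := by
    intro z hz
    rw [hM, List.mem_append, List.mem_reverse] at hz
    rw [hsplit, List.mem_append]
    exact hz.imp_right fun h => List.mem_append_right _ h
  have hMnd : M.Nodup := by
    rw [hsplit, List.nodup_append'] at hnd'
    rw [hM, List.nodup_append']
    refine ⟨List.nodup_reverse.2 hnd'.1, hnd'.2.1.of_append_right, fun z hz hz' => ?_⟩
    exact hnd'.2.2 (List.mem_reverse.1 hz) (List.mem_append_right _ hz')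
  have hMch : M.IsChain G.Adj := by
    rw [hsplit] at hch'
    rw [hM, hγ, List.reverse_cons, List.append_assoc, List.cons_append, List.nil_append,
      List.isChain_append_cons_cons, ← List.reverse_cons, ← hγ, isChain_adj_reverse]
    exact ⟨hch'.left_of_append, hw', hch'.right_of_append.right_of_append⟩
  have hMC : ∀ z ∈ M, z ∉ C := by
    intro z hz
    have := hMsub z hz
    refine hp.off z ?_
    simp only [List.mem_append, List.mem_cons, List.cons_append] at this ⊢
    grind
  obtain ⟨M', hM'⟩ : ∃ M', M = w :: M' := ⟨α.reverse ++ w' :: β₂, by simp [hM]⟩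
  obtain ⟨M'', hM''⟩ : ∃ M'', M = M'' ++ [q₀] := by
    rcases List.eq_nil_or_concat β₂ with rfl | ⟨δ, u, rfl⟩
    · have := (List.append_inj' hβ rfl).2
      exact ⟨(α ++ [w]).reverse, by rw [hM, ← this]⟩
    · have : β ++ [q₀] = (β₁ ++ w' :: δ) ++ [u] := by simpa using hβ
      have := (List.append_inj' this rfl).2
      exact ⟨(α ++ [w]).reverse ++ w' :: δ, by rw [hM, this]; simp⟩
  have hlen := hC.two_mul_length_le (m := a ++ (M ++ b)) hx₁ hx₂ hne (by simp [hM']) ?_ ?_ ?_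
  · have hsub : D.filter (G.Adj v) ⊆ M.toFinset.erase v := by
      intro z hz
      rw [Finset.mem_filter] at hz
      have hzl := hN z hz.1 hz.2
      rw [Finset.mem_erase, List.mem_toFinset]
      refine ⟨hz.2.ne', ?_⟩
      have hz' : z ∈ v :: s ++ [q₀] := by
        have : z ∉ rest := fun h => hrest z h hz
        simp only [List.mem_append, List.mem_cons, List.cons_append] at hzl ⊢
        grind
      rw [hsplit, List.mem_append] at hz'
      rw [hM, List.mem_append, List.mem_reverse]
      exact hz'.imp_right fun h =>
        (List.mem_append.1 h).resolve_left fun h => hβ₁ z h hz.2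
    have hvM : v ∈ M := by rw [hM, List.mem_append, List.mem_reverse, hγ]; simp
    have hc := Finset.card_le_card hsub
    rw [Finset.card_erase_of_mem (List.mem_toFinset.2 hvM), List.toFinset_card_of_nodup hMnd] at hc
    have hpos : 0 < M.length := List.length_pos_of_mem hvM
    have : degIn G v D ≤ M.length - 1 := hc
    simp only [List.length_append] at hlen
    omega
  · have e1 : x₁ :: (a ++ (M ++ b) ++ [x₂]) = (x₁ :: a) ++ w :: (M' ++ (b ++ [x₂])) := by
      rw [hM']; simp
    have e2 : w :: (M' ++ (b ++ [x₂])) = M'' ++ q₀ :: (b ++ [x₂]) := by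
      rw [← List.cons_append, ← hM', hM'']; simp
    rw [e1, List.isChain_split, e2]
    exact ⟨hach, List.isChain_split.2 ⟨hM'' ▸ hMch, hbch⟩⟩
  · rw [List.nodup_append', List.nodup_append']
    refine ⟨hand, ⟨hMnd, hbnd, fun z hz hz' => hb z hz' (hMsub z hz)⟩, fun z hz hz' => ?_⟩
    rcases List.mem_append.1 hz' with h | h
    · exact ha z hz (hMsub z h)
    · exact hab z hz h
  · intro z hz
    simp only [List.mem_append] at hz
    rcases hz with hz | hz | hz
    · exact haC z hz
    · exact hMC z hz
    · exact hbC z hz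

open Classical in
/-- The neighbourhood of the first vertex of a longest access path, when its degree is large. -/
theorem IsAccessPath.neighbors_of_longest (h2 : IsTwoConnected G) {C l : List V} {D : Finset V}
    {v y : V} {t : ℕ} (ht : 2 ≤ t) (hC : IsLongestCycle G C) (hCt : C.length ≤ 2 * t + 1)
    (hD : ∀ z ∈ D, z ∉ C) (hp : IsAccessPath G C D v l y)
    (hmax : ∀ v' l' y', IsAccessPath G C D v' l' y' → l'.length ≤ l.length)
    (hdeg : t ≤ degIn G v D + degIn G v C.toFinset) :
    D.filter (G.Adj v) = l.toFinset ∧ G.Adj v y ∧ degIn G v C.toFinset + l.length = t := by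
  have hN : ∀ z ∈ D, G.Adj v z → z ∈ l := by
    intro z hz hvz
    by_contra hzl
    have := hmax z (v :: l) y ⟨hz, hp.exit,
      List.nodup_cons.2 ⟨by simp [hvz.ne', hzl], hp.nodup⟩,
      List.isChain_cons_cons.2 ⟨hvz.symm, hp.chain⟩,
      List.forall_mem_cons.2 ⟨hD z hz, hp.off⟩⟩
    simp at this
  have hsub : D.filter (G.Adj v) ⊆ l.toFinset := by
    intro z hz
    rw [Finset.mem_filter] at hz
    exact List.mem_toFinset.2 (hN z hz.1 hz.2)
  have hll : l.toFinset.card = l.length := List.toFinset_card_of_nodup hp.nodup.of_cons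
  have hdl : degIn G v D ≤ l.length := hll ▸ Finset.card_le_card hsub
  have hx1 : degIn G v C.toFinset ≤ ((C.toFinset.filter (G.Adj v)).erase y).card + 1 := by
    have := Finset.pred_card_le_card_erase (s := C.toFinset.filter (G.Adj v)) (a := y)
    unfold degIn
    omega
  rcases Finset.eq_empty_or_nonempty ((C.toFinset.filter (G.Adj v)).erase y) with h0 | hne
  -- At most one neighbour on `C` means at least `t - 1 ≥ 1` in `D`, and the long detour would need
  -- `2t + 2 ≤ C.length`.
  · rw [h0, Finset.card_empty] at hx1
    have := hp.exists_long_detour h2 hC hN (by omega)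
    omega
  -- This bound meets `hdeg` with no slack: all of `l` must be adjacent to `v`, and `y` must be too.
  · have hcount := hC.two_mul_length_add_card_le hp.exit hp.nodup hp.chain hp.off hne
    rw [List.length_cons] at hcount
    refine ⟨Finset.eq_of_subset_of_card_le hsub ?_, ?_, by omega⟩
    · have : degIn G v D = (D.filter (G.Adj v)).card := rfl
      omega
    · by_contra hvy
      have : (C.toFinset.filter (G.Adj v)).erase y = C.toFinset.filter (G.Adj v) :=
        Finset.erase_eq_of_notMem (by simp [hvy])
      have h3 : degIn G v C.toFinset = (C.toFinset.filter (G.Adj v)).card := rfl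
      rw [this] at hcount
      omega

theorem exists_max_nat {P : ℕ → Prop} {n b : ℕ} (hn : P n) (hb : ∀ m, P m → m ≤ b) :
    ∃ N, P N ∧ n ≤ N ∧ ∀ m, P m → m ≤ N := by
  classical
  exact ⟨Nat.findGreatest P b, Nat.findGreatest_spec (hb n hn) hn,
    Nat.le_findGreatest (hb n hn) hn, fun m hm => Nat.le_findGreatest (hb m hm) hm⟩

/-- Prepend `v` to a path from `w` to `C` in `G - v`. The bound `1 ≤ l.length` is what later gains
the half edge per vertex. -/
theorem IsTwoConnected.exists_isAccessPath (h2 : IsTwoConnected G) {C : List V} {D : Finset V}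
    (hC : IsLongestCycle G C) {v w : V} (hv : v ∈ D) (hvC : v ∉ C) (hw : w ∉ C)
    (hvw : G.Adj v w) : ∃ l y, IsAccessPath G C D v l y ∧ 1 ≤ l.length := by
  obtain ⟨c, hc, -⟩ := hC.nontrivial
  obtain ⟨x, m, m', y, hm, hnd, hch, hvm, hx, -, hy, hm'⟩ :=
    h2.exists_path (A := {w}) (B := {z | z ∈ C}) (a := w) (b := c) (v := v) rfl hc hvw.ne'
      (fun e => hvC (e ▸ hc))
  obtain rfl : x = w := hx
  have hm'0 : m' ≠ [] := by
    rintro rfl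
    simp at hm
    exact hw (hm.1 ▸ hy)
  rw [hm] at hnd hvm
  refine ⟨m', y, ⟨hv, hy, ?_, ?_, ?_⟩, List.length_pos_iff.2 hm'0⟩
  · exact List.nodup_cons.2 ⟨fun h => hvm (List.mem_append_left _ h), hnd.of_append_left⟩
  · rw [← hm]
    exact List.isChain_cons_cons.2 ⟨hvw, hch⟩
  · exact List.forall_mem_cons.2 ⟨hvC, hm'⟩

/-- Reversing the initial segment of an access path whose first vertex is adjacent to everything. -/
theorem IsAccessPath.rotate {C l : List V} {D : Finset V} {v y : V}
    (hp : IsAccessPath G C D v l y) (hl : ∀ z ∈ l ++ [y], G.Adj v z) {α β : List V} {u : V}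
    (hu : u ∈ D) (h : v :: l = α ++ u :: β) : IsAccessPath G C D u (α.reverse ++ β) y := by
  have hperm : (u :: (α.reverse ++ β)).Perm (v :: l) := by
    rw [h]
    exact ((List.reverse_perm α).append_right β).cons u |>.trans List.perm_middle.symm
  refine ⟨hu, hp.exit, hperm.nodup_iff.2 hp.nodup, ?_, fun z hz => hp.off z (hperm.mem_iff.1 hz)⟩
  cases α with
  | nil =>
    simp only [List.nil_append, List.cons.injEq] at h
    rw [← h.1, ← h.2]
    exact hp.chain
  | cons a α =>
    simp only [List.cons_append, List.cons.injEq] at h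
    obtain ⟨rfl, rfl⟩ := h
    have hch : (v :: (α ++ [u])  ++ (β ++ [y])).IsChain G.Adj := by simpa using hp.chain
    have hch1 : (u :: (α.reverse ++ [v])).IsChain G.Adj := by
      have := isChain_adj_reverse.2 hch.left_of_append
      simpa using this
    have e : u :: ((v :: α).reverse ++ β ++ [y]) = u :: α.reverse ++ v :: (β ++ [y]) := by simp
    rw [e, List.isChain_split]
    refine ⟨hch1, List.isChain_cons.2 ⟨fun z hz => hl z ?_, hch.right_of_append⟩⟩
    have := List.mem_of_mem_head? hz
    simp only [List.mem_append, List.mem_cons] at this ⊢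
    tauto

-- If no singleton works, every vertex of `D` has degree at least `t` into `D` and `C` together. The
-- vertices of a longest access path then work: by rotation each of them starts an equally long
-- access path on the same vertex set.
open Classical in
theorem exists_sparse_subset [Fintype V] (h2 : IsTwoConnected G) {C : List V} {t : ℕ} (ht : 2 ≤ t)
    (hC : IsLongestCycle G C) (hCt : C.length ≤ 2 * t + 1) {D : Finset V} (hD0 : D.Nonempty)
    (hD : ∀ v ∈ D, v ∉ C ∧ ∃ w, w ∉ C ∧ G.Adj v w) :
    ∃ S ⊆ D, S.Nonempty ∧
      ∑ v ∈ S, (degIn G v S + 2 * degIn G v (D \ S) + 2 * degIn G v C.toFinset) ≤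
        (2 * t - 1) * S.card := by
  by_contra! hcon
  have hdeg : ∀ v ∈ D, t ≤ degIn G v D + degIn G v C.toFinset := by
    intro v hv
    have h := hcon {v} (by simpa using hv) (by simp)
    have h0 : degIn G v {v} = 0 := degIn_eq_zero.2 (by simp)
    have h1 := degIn_sdiff_add (G := G) (Finset.singleton_subset_iff.2 hv) v
    simp only [Finset.sum_singleton, Finset.card_singleton] at h
    omega
  obtain ⟨v₀, hv₀⟩ := hD0
  obtain ⟨hv₀C, w₀, hw₀, hvw₀⟩ := hD v₀ hv₀
  obtain ⟨l₀, y₀, hp₀, hl₀⟩ := h2.exists_isAccessPath hC hv₀ hv₀C hw₀ hvw₀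
  obtain ⟨N, ⟨v, l, y, hp, rfl⟩, hN1, hmax⟩ := exists_max_nat
    (P := fun n => ∃ v l y, IsAccessPath G C D v l y ∧ l.length = n) (b := Fintype.card V)
    ⟨v₀, l₀, y₀, hp₀, rfl⟩ (by
      rintro _ ⟨v, l, y, hp, rfl⟩
      exact hp.nodup.of_cons.length_le_card)
  have hend : ∀ v' l' y', IsAccessPath G C D v' l' y' → l'.length = l.length →
      D.filter (G.Adj v') = l'.toFinset ∧ G.Adj v' y' ∧
        degIn G v' C.toFinset + l'.length = t := by
    intro v' l' y' hp' hl'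
    exact hp'.neighbors_of_longest h2 ht hC hCt (fun z hz => (hD z hz).1)
      (fun v'' l'' y'' hp'' => hl' ▸ hmax _ ⟨v'', l'', y'', hp'', rfl⟩) (hdeg v' hp'.mem)
  obtain ⟨hv1, hv2, hv3⟩ := hend v l y hp rfl
  have hlD : ∀ z ∈ l, z ∈ D ∧ G.Adj v z := by
    intro z hz
    rw [← List.mem_toFinset, ← hv1, Finset.mem_filter] at hz
    exact hz
  have hSD : (v :: l).toFinset ⊆ D := by
    intro z hz
    rw [List.mem_toFinset] at hz
    rcases List.mem_cons.1 hz with rfl | hz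
    · exact hp.mem
    · exact (hlD z hz).1
  have hScard : (v :: l).toFinset.card = l.length + 1 := by
    rw [List.toFinset_card_of_nodup hp.nodup, List.length_cons]
  have hadj : ∀ z ∈ l ++ [y], G.Adj v z := by
    intro z hz
    rw [List.mem_append, List.mem_singleton] at hz
    rcases hz with hz | rfl
    · exact (hlD z hz).2
    · exact hv2
  have hlt : l.length ≤ t := by omega
  -- With `m = l.length`, the vertex `u` has at most `m` neighbours in the set, none in the rest of
  -- `D`, and `t - m` on `C`. The total is at most `2t - m ≤ 2t - 1`.
  have key : ∀ u ∈ (v :: l).toFinset, degIn G u (v :: l).toFinset +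
      2 * degIn G u (D \ (v :: l).toFinset) + 2 * degIn G u C.toFinset ≤ 2 * t - 1 := by
    intro u hu
    have huD := hSD hu
    rw [List.mem_toFinset] at hu
    obtain ⟨α, β, hαβ⟩ := List.append_of_mem hu
    have hlen : (α.reverse ++ β).length = l.length := by
      have := congrArg List.length hαβ
      simp at this ⊢
      omega
    obtain ⟨hu1, -, hu3⟩ := hend u _ y (hp.rotate hadj huD hαβ) hlen
    have hdu : degIn G u D ≤ l.length := by
      have h1 : degIn G u D = (D.filter (G.Adj u)).card := rfl
      rw [h1, hu1, ← hlen]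
      exact List.toFinset_card_le _
    have h0 : degIn G u (D \ (v :: l).toFinset) = 0 := by
      rw [degIn_eq_zero]
      intro w hw huw
      rw [Finset.mem_sdiff, List.mem_toFinset] at hw
      have : w ∈ (α.reverse ++ β).toFinset := by
        rw [← hu1, Finset.mem_filter]; exact ⟨hw.1, huw⟩
      apply hw.2
      rw [hαβ]
      simp only [List.mem_toFinset, List.mem_append, List.mem_reverse, List.mem_cons] at this ⊢
      tauto
    have h4 := degIn_mono (G := G) hSD u
    omega
  have := hcon _ hSD ⟨v, by simp⟩
  have h5 := Finset.sum_le_card_nsmul _ _ _ key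
  rw [smul_eq_mul, mul_comm] at h5
  omega

open Classical in
/-- The edges meeting the nontrivial components outside a longest cycle are few. -/
theorem sum_degIn_outside_le [Fintype V] (h2 : IsTwoConnected G) {C : List V} {t : ℕ} (ht : 2 ≤ t)
    (hC : IsLongestCycle G C) (hCt : C.length ≤ 2 * t + 1) : ∀ D : Finset V,
    (∀ v ∈ D, v ∉ C ∧ ∃ w, w ∉ C ∧ G.Adj v w) →
    ∑ v ∈ D, (degIn G v D + 2 * degIn G v C.toFinset) ≤ (2 * t - 1) * D.card := by
  intro D
  induction D using Finset.strongInduction with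
  | H D ih =>
    intro hD
    rcases D.eq_empty_or_nonempty with rfl | hD0
    · simp
    obtain ⟨S, hSD, hS0, hS⟩ := exists_sparse_subset h2 ht hC hCt hD0 hD
    -- The induction hypothesis applies because the neighbour `w` is only required to lie off `C`,
    -- not in `D`; for the same reason access paths may leave `D` after their first vertex.
    have h1 := ih (D \ S) (Finset.sdiff_ssubset hSD hS0)
      (fun v hv => hD v (Finset.sdiff_subset hv))
    have hcard := Finset.card_sdiff_add_card_eq_card hSD
    have h3 : ∑ v ∈ D, (degIn G v D + 2 * degIn G v C.toFinset) =
        ∑ v ∈ S, (degIn G v S + 2 * degIn G v (D \ S) + 2 * degIn G v C.toFinset) +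
        ∑ v ∈ D \ S, (degIn G v (D \ S) + 2 * degIn G v C.toFinset) := by
      rw [← Finset.sum_sdiff hSD]
      simp only [← degIn_sdiff_add hSD, Finset.sum_add_distrib, ← Finset.mul_sum]
      have := sum_degIn_comm (G := G) (D \ S) S
      omega
    rw [h3, ← hcard, mul_add]
    omega

end Outside

/-! ### Existence of a longest cycle, and cycle lists as copies of `cycleGraph`. -/

section LongestCycle

variable {V : Type*} {G : SimpleGraph V}

theorem IsTwoConnected.exists_adj_ne [Fintype V] (h : IsTwoConnected G) (x a : V) (hxa : x ≠ a) :
    ∃ b, b ≠ a ∧ G.Adj x b := by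
  classical
  obtain ⟨z, hz⟩ : ∃ z, z ∉ ({x, a} : Finset V) := by
    by_contra! hall
    have h1 : Finset.univ ⊆ ({x, a} : Finset V) := fun z _ => hall z
    have h2 := Finset.card_le_card h1
    have h3 := h.1
    rw [Nat.card_eq_fintype_card] at h3
    have h4 : ({x, a} : Finset V).card ≤ 2 := Finset.card_le_two
    rw [Finset.card_univ] at h2
    omega
  simp only [Finset.mem_insert, Finset.mem_singleton, not_or] at hz
  obtain ⟨x', m, m', y, hm, -, hch, ha, hx', -, hy, -⟩ :=
    h.exists_path (A := {x}) (B := {z}) (v := a) rfl rfl hxa hz.2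
  obtain rfl : x' = x := hx'
  obtain rfl : y = z := hy
  cases m with
  | nil =>
    cases m' with
    | nil => simp at hm; exact absurd hm.symm hz.1
    | cons b m' => simp at hm
  | cons b m =>
    rw [List.isChain_cons_cons] at hch
    exact ⟨b, fun e => ha (by simp [e]), hch.1⟩

theorem IsTwoConnected.exists_isCycleList [Fintype V] (h : IsTwoConnected G) :
    ∃ l, IsCycleList G l := by
  obtain ⟨x⟩ := h.2.1.nonempty
  have : Nontrivial V := by
    rw [← Fintype.one_lt_card_iff_nontrivial, ← Nat.card_eq_fintype_card]
    exact lt_of_lt_of_le (by norm_num) h.1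
  obtain ⟨y, hy⟩ := exists_ne x
  obtain ⟨a, -, hxa⟩ := h.exists_adj_ne x y hy.symm
  obtain ⟨b, hba, hxb⟩ := h.exists_adj_ne x a hxa.ne
  obtain ⟨a', m, m', b', hm, hnd, hch, hx, ha, -, hb, -⟩ :=
    h.exists_path (A := {a}) (B := {b}) (v := x) rfl rfl hxa.ne' hxb.ne'
  obtain rfl : a' = a := ha
  obtain rfl : b' = b := hb
  refine ⟨x :: a' :: m, isCycleList_cons.2 ⟨List.nodup_cons.2 ⟨hx, hnd⟩, ?_, ?_⟩⟩
  · cases m with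
    | nil =>
      cases m' with
      | nil => simp at hm; exact absurd hm.symm hba
      | cons b m' => simp at hm
    | cons b m => simp
  · have e : x :: (a' :: m ++ [x]) = x :: m' ++ b' :: [x] := by rw [hm]; simp
    rw [e, List.isChain_append_cons_cons]
    refine ⟨?_, hxb.symm, by simp⟩
    rw [List.cons_append, ← hm]
    exact List.isChain_cons_cons.2 ⟨hxa, hch⟩

theorem IsTwoConnected.exists_isLongestCycle [Fintype V] (h : IsTwoConnected G) :
    ∃ C, IsLongestCycle G C := by
  obtain ⟨l, hl⟩ := h.exists_isCycleList
  obtain ⟨N, ⟨C, hC, rfl⟩, -, hmax⟩ := exists_max_nat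
    (P := fun n => ∃ l, IsCycleList G l ∧ l.length = n) (b := Fintype.card V) ⟨l, hl, rfl⟩ (by
      rintro _ ⟨l, hl, rfl⟩
      exact hl.1.length_le_card)
  exact ⟨C, hC, fun l hl => hmax _ ⟨l, hl, rfl⟩⟩

theorem IsCycleList.adj_getElem {l : List V} (h : IsCycleList G l) {i j : ℕ} (hi : i < l.length)
    (hj : j < l.length) (hij : (i + 1) % l.length = j) : G.Adj l[i] l[j] := by
  cases l with
  | nil => simp at hi
  | cons x l =>
    have hch := List.isChain_iff_getElem.1 (isCycleList_cons.1 h).2.2 i (by simp at hi ⊢; omega)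
    subst hij
    simp only [List.length_cons] at hi hj
    rcases Nat.lt_or_ge (i + 1) (l.length + 1) with h1 | h1
    · convert hch using 1
      · simp only [← List.cons_append]
        rw [List.getElem_append_left (by simp; omega)]
      · simp only [← List.cons_append]
        rw [List.getElem_append_left (by simp; omega)]
        simp only [List.length_cons, Nat.mod_eq_of_lt h1]
    · have h2 : i = l.length := by omega
      subst h2
      convert hch using 1
      · simp only [← List.cons_append]
        rw [List.getElem_append_left (by simp)]
      · simp

theorem IsCycleList.isContained {l : List V} (h : IsCycleList G l) :
    (SimpleGraph.cycleGraph l.length).IsContained G := by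
  refine ⟨⟨⟨fun i => l[i], ?_⟩, fun i j hij => ?_⟩⟩
  · intro i j hij
    have h3 := h.2.1
    have key : ∀ a b : Fin l.length, (a - b).val = 1 → G.Adj l[b] l[a] := by
      intro a b hab
      apply h.adj_getElem
      rw [Fin.sub_def] at hab
      simp only at hab
      have ha := a.2
      have hb := b.2
      have h4 : (l.length - b + a) % l.length = 1 % l.length := by
        rw [hab, Nat.mod_eq_of_lt (by omega)]
      have h5 := Nat.ModEq.add_right (b : ℕ) (show (l.length - b + a) ≡ 1 [MOD l.length] from h4)
      have h6 : l.length - b + a + b = a + l.length := by omega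
      rw [h6, add_comm 1] at h5
      have h7 : (b + 1 : ℕ) % l.length = (a + l.length) % l.length := h5.symm
      rw [h7, Nat.add_mod_right, Nat.mod_eq_of_lt ha]
    rcases SimpleGraph.cycleGraph_adj'.1 hij with h1 | h1
    · exact (key _ _ h1).symm
    · exact key _ _ h1
  · exact Fin.ext ((List.Nodup.getElem_inj_iff h.1).1 hij)

end LongestCycle

/-! ### Successors on a longest cycle of the neighbours of an outside vertex. -/

section Crossing

variable {V : Type*} [DecidableEq V] {G : SimpleGraph V} {C : List V} {v a b : V}

theorem IsLongestCycle.not_adj_formPerm (hC : IsLongestCycle G C) (hv : v ∉ C) (ha : a ∈ C)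
    (hva : G.Adj v a) : ¬ G.Adj v (C.formPerm a) := by
  obtain ⟨γ, hγ⟩ := exists_isRotated_cons_of_mem ha
  have hC' := hC.of_isRotated hγ
  rw [List.formPerm_eq_of_isRotated hC.1.1 hγ]
  cases γ with
  | nil => have := hC'.1.2.1; simp at this
  | cons u γ =>
    rw [List.formPerm_apply_head _ _ _ hC'.1.1]
    intro hvu
    have := hC'.length_le_arc (α := []) (m := [v]) (y := u) (β := γ) (by simp)
      (by simp [hva.symm, hvu]) (by simp) (by
        intro z hz h
        rw [List.mem_singleton.1 hz] at h
        exact hv (hγ.mem_iff.2 h))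
    simp at this

/-- The successors on a longest cycle of the neighbours of a vertex outside it are independent. -/
theorem IsLongestCycle.not_adj_formPerm_formPerm (hC : IsLongestCycle G C) (hv : v ∉ C)
    (ha : a ∈ C) (hb : b ∈ C) (hva : G.Adj v a) (hvb : G.Adj v b) (hab : a ≠ b) :
    ¬ G.Adj (C.formPerm a) (C.formPerm b) := by
  obtain ⟨γ, hγ⟩ := exists_isRotated_cons_of_mem ha
  obtain ⟨α, β, rfl⟩ := List.append_of_mem
    (List.mem_of_ne_of_mem hab.symm (hγ.mem_iff.1 hb))
  have hC' := hC.of_isRotated hγ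
  have hr : a :: (α ++ b :: β) ~r b :: (β ++ a :: α) := by
    simpa using List.isRotated_append (l := a :: α) (l' := b :: β)
  have hva' := hC.not_adj_formPerm hv ha hva
  have hvb' := hC.not_adj_formPerm hv hb hvb
  have e1 := List.formPerm_eq_of_isRotated hC.1.1 hγ
  have e2 := List.formPerm_eq_of_isRotated hC.1.1 (hγ.trans hr)
  rw [e1] at hva' ⊢
  rw [show C.formPerm = _ from e2] at hvb'
  rw [show (a :: (α ++ b :: β)).formPerm b = (b :: (β ++ a :: α)).formPerm b by rw [← e1, e2]]
  have hnd := hC'.1.1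
  have hnd' := (hC'.of_isRotated hr).1.1
  rcases α with - | ⟨u, α⟩
  · simp only [List.nil_append] at hva' hnd
    rw [List.formPerm_apply_head _ _ _ hnd] at hva'
    exact absurd hvb hva'
  rcases β with - | ⟨w, β⟩
  · simp only [List.nil_append] at hvb' hnd'
    rw [List.formPerm_apply_head _ _ _ hnd'] at hvb'
    exact absurd hva hvb'
  simp only [List.cons_append] at hnd hnd' ⊢
  rw [List.formPerm_apply_head _ _ _ hnd, List.formPerm_apply_head _ _ _ hnd']
  intro huw
  have hvC : v ∉ a :: (u :: α ++ b :: w :: β) := fun h => hv (hγ.mem_iff.2 h)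
  have hperm : (a :: (β.reverse ++ w :: u :: (α ++ [b]))).Perm (a :: (u :: α ++ b :: w :: β)) := by
    rw [List.perm_iff_count]
    intro z
    simp only [List.count_cons, List.count_append, List.count_reverse, List.count_nil]
    omega
  -- The classical exchange: from `v` to `a`, backwards to the successor `w` of `b`, across to the
  -- successor `u` of `a`, forwards to `b`, and back to `v`. It is one vertex longer than `C`.
  have hcyc : IsCycleList G (v :: a :: (β.reverse ++ w :: u :: (α ++ [b]))) := by
    have hch := (isCycleList_cons.1 hC'.1).2.2
    have e3 : a :: (u :: α ++ b :: w :: β ++ [a]) = a :: u :: (α ++ b :: (w :: β ++ [a])) := by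
      simp
    rw [e3, List.isChain_cons_cons, List.isChain_cons_split] at hch
    obtain ⟨-, h1, h2⟩ := hch
    rw [isCycleList_cons]
    refine ⟨List.nodup_cons.2 ⟨fun h => hvC (hperm.mem_iff.1 h), hperm.nodup_iff.2 hC'.1.1⟩,
      by simp; omega, ?_⟩
    have e4 : v :: (a :: (β.reverse ++ w :: u :: (α ++ [b])) ++ [v]) =
        v :: a :: (β.reverse ++ w :: u :: (α ++ b :: [v])) := by simp
    rw [e4, List.isChain_cons_cons, List.isChain_cons_append_cons_cons]
    refine ⟨hva, ?_, huw.symm, List.isChain_cons_split.2 ⟨h1, by simp [hvb.symm]⟩⟩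
    have := isChain_adj_reverse.2 h2.tail
    simpa using this
  have := hC'.2 _ hcyc
  have h5 := hperm.length_eq
  simp at this h5
  omega

end Crossing

/-! ### Turán-type bounds for degree sums. -/

section CliqueCounting

variable {V : Type*} {G : SimpleGraph V}

theorem sum_degIn_induce (A : Finset V) [DecidableEq V] [DecidableRel G.Adj] :
    ∑ x ∈ A, degIn G x A = 2 * (G.induce (A : Set V)).edgeFinset.card := by
  rw [← SimpleGraph.sum_degrees_eq_twice_card_edges, ← Finset.sum_coe_sort A]
  refine Finset.sum_congr rfl fun x _ => ?_
  unfold degIn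
  rw [← SimpleGraph.card_neighborFinset_eq_degree]
  symm
  refine Finset.card_bij (fun (y : A) _ => (y : V)) ?_ ?_ ?_
  · intro y hy
    rw [SimpleGraph.mem_neighborFinset, SimpleGraph.comap_adj] at hy
    simp only [Finset.mem_filter]
    exact ⟨y.2, hy⟩
  · intro y _ z _ h; exact Subtype.ext h
  · intro y hy
    simp only [Finset.mem_filter] at hy
    refine ⟨⟨y, hy.1⟩, ?_, rfl⟩
    rw [SimpleGraph.mem_neighborFinset, SimpleGraph.comap_adj]
    exact hy.2

theorem card_edgeFinset_le_of_cliqueFree {W : Type*} [Fintype W] {H : SimpleGraph W}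
    [Fintype H.edgeSet] {s : ℕ} (h : H.CliqueFree s) :
    H.edgeFinset.card ≤
      SimpleGraph.extremalNumber (Fintype.card W) (⊤ : SimpleGraph (Fin s)) := by
  classical
  have h' : (⊤ : SimpleGraph (Fin s)).Free H := by
    rw [← SimpleGraph.cliqueFree_iff_top_free, Fintype.card_fin]; exact h
  convert SimpleGraph.card_edgeFinset_le_extremalNumber h'

/-- With at least `s` vertices `H` is not complete, and adding one missing edge leaves it
`K_{s+1}`-free. -/
theorem card_edgeFinset_lt_of_cliqueFree {W : Type*} [Fintype W] {H : SimpleGraph W}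
    [Fintype H.edgeSet] {s : ℕ} (h : H.CliqueFree s) (hs : s ≤ Fintype.card W) :
    H.edgeFinset.card <
      SimpleGraph.extremalNumber (Fintype.card W) (⊤ : SimpleGraph (Fin (s + 1))) := by
  classical
  obtain ⟨x, y, hxy, hn⟩ : ∃ x y, x ≠ y ∧ ¬ H.Adj x y := by
    by_contra! hall
    obtain ⟨K, -, hK⟩ := Finset.exists_subset_card_eq
      (show s ≤ (Finset.univ : Finset W).card by rwa [Finset.card_univ])
    exact h K ⟨fun a _ b _ hab => hall a b hab, hK⟩
  have := card_edgeFinset_le_of_cliqueFree (h.sup_edge x y)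
  have h2 := H.card_edgeFinset_sup_edge hn hxy
  rw [h2] at this
  have h3 : H.edgeFinset.card + 1 ≤ SimpleGraph.extremalNumber (Fintype.card W)
      (⊤ : SimpleGraph (Fin (s + 1))) := by convert this
  exact h3

theorem cliqueFree_induce_of_forall {A : Finset V} {s : ℕ}
    (h : ∀ K ⊆ A, ¬ G.IsNClique s K) : (G.induce (A : Set V)).CliqueFree s := by
  intro K hK
  refine h (K.map (Function.Embedding.subtype _)) ?_ ⟨?_, ?_⟩
  · intro x hx
    simp only [Finset.mem_map, Function.Embedding.subtype_apply] at hx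
    obtain ⟨y, -, rfl⟩ := hx
    exact y.2
  · intro x hx y hy hxy
    simp only [Finset.coe_map, Set.mem_image, Function.Embedding.subtype_apply] at hx hy
    obtain ⟨x, hx, rfl⟩ := hx
    obtain ⟨y, hy, rfl⟩ := hy
    exact hK.1 hx hy (fun e => hxy (congrArg _ e))
  · rw [Finset.card_map, hK.2]

theorem sum_degIn_le_extremalNumber {A : Finset V} {s : ℕ} (h : ∀ K ⊆ A, ¬ G.IsNClique s K) :
    ∑ x ∈ A, degIn G x A ≤ 2 * SimpleGraph.extremalNumber A.card (⊤ : SimpleGraph (Fin s)) := by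
  classical
  have := card_edgeFinset_le_of_cliqueFree (cliqueFree_induce_of_forall h)
  rw [sum_degIn_induce]
  simpa using this

theorem sum_degIn_lt_extremalNumber {A : Finset V} {s : ℕ} (h : ∀ K ⊆ A, ¬ G.IsNClique s K)
    (hs : s ≤ A.card) : ∑ x ∈ A, degIn G x A + 2 ≤
      2 * SimpleGraph.extremalNumber A.card (⊤ : SimpleGraph (Fin (s + 1))) := by
  classical
  have := card_edgeFinset_lt_of_cliqueFree (cliqueFree_induce_of_forall h) (by simpa using hs)
  rw [sum_degIn_induce]
  simp only [Finset.coe_sort_coe, Fintype.card_coe] at this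
  omega

theorem sum_degIn_eq_add {S D : Finset V} [DecidableEq V] (h : S ⊆ D) :
    ∑ v ∈ D, degIn G v D = ∑ v ∈ S, degIn G v S + 2 * ∑ v ∈ D \ S, degIn G v S +
      ∑ v ∈ D \ S, degIn G v (D \ S) := by
  rw [← Finset.sum_sdiff h]
  simp only [← degIn_sdiff_add h, Finset.sum_add_distrib]
  have := sum_degIn_comm (G := G) (D \ S) S
  omega

/-- Degree count inside `D ⊇ A` when some vertex is complete to `A` and `D \ A` spans at most
one edge. -/
theorem sum_degIn_le_of_one_edge [DecidableEq V] {A D : Finset V} {v : V} {r : ℕ} (hr : 3 ≤ r)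
    (hrA : r ≤ A.card + 1) (hG : G.CliqueFree r) (hAD : A ⊆ D) (hv : ∀ x ∈ A, G.Adj v x)
    {u w : V} (huw : ∀ x ∈ D \ A, ∀ y ∈ D \ A, G.Adj x y → x = u ∧ y = w ∨ x = w ∧ y = u) :
    ∑ x ∈ D, degIn G x D ≤
      2 * SimpleGraph.extremalNumber A.card (⊤ : SimpleGraph (Fin (r - 1))) +
        2 * (A.card * (D.card - A.card)) := by
  have hcardB : (D \ A).card = D.card - A.card := Finset.card_sdiff_of_subset hAD
  rw [sum_degIn_eq_add hAD, ← hcardB]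
  have hA1 : ∀ K ⊆ A, ¬ G.IsNClique (r - 1) K := by
    intro K hKA hK
    have := hK.insert (a := v) fun x hx => hv x (hKA hx)
    rw [Nat.sub_add_cancel (by omega)] at this
    exact hG _ this
  have hAA := sum_degIn_le_extremalNumber hA1
  have hBA : ∑ x ∈ D \ A, degIn G x A ≤ A.card * (D \ A).card := by
    have := Finset.sum_le_card_nsmul (D \ A) (fun x => degIn G x A) _
      fun x _ => degIn_le_card x A
    rwa [smul_eq_mul, mul_comm] at this
  by_cases hedge : ∃ x ∈ D \ A, ∃ y ∈ D \ A, G.Adj x y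
  · obtain ⟨x, hx, y, hy, hxy⟩ := hedge
    have hB : ∀ x' ∈ D \ A, ∀ y' ∈ D \ A, G.Adj x' y' → x' = x ∧ y' = y ∨ x' = y ∧ y' = x := by
      intro x' hx' y' hy' h
      rcases huw x hx y hy hxy with ⟨rfl, rfl⟩ | ⟨rfl, rfl⟩ <;>
        rcases huw x' hx' y' hy' h with ⟨rfl, rfl⟩ | ⟨rfl, rfl⟩ <;> simp
    have hBB : ∑ z ∈ D \ A, degIn G z (D \ A) ≤ 2 := by
      have hsub : ∑ z ∈ ({x, y} : Finset V), degIn G z (D \ A) =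
          ∑ z ∈ D \ A, degIn G z (D \ A) := by
        refine Finset.sum_subset ?_ ?_
        · intro z hz
          rw [Finset.mem_insert, Finset.mem_singleton] at hz
          rcases hz with rfl | rfl <;> assumption
        · intro z hz hz'
          rw [degIn_eq_zero]
          intro z' hz1 hzz
          rcases hB z hz z' hz1 hzz with ⟨rfl, -⟩ | ⟨rfl, -⟩ <;> simp at hz'
      have h1 : ∀ p q, (∀ y' ∈ D \ A, G.Adj p y' → y' = q) → degIn G p (D \ A) ≤ 1 := by
        intro p q hpq
        classical
        unfold degIn
        rw [Finset.card_le_one]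
        intro a ha b hb
        rw [Finset.mem_filter] at ha hb
        rw [hpq a ha.1 ha.2, hpq b hb.1 hb.2]
      rw [← hsub, Finset.sum_pair hxy.ne]
      have hx1 := h1 x y fun y' hy' h => by
        rcases hB x hx y' hy' h with h | h
        · exact h.2
        · exact absurd h.1 hxy.ne
      have hy1 := h1 y x fun y' hy' h => by
        rcases hB y hy y' hy' h with h | h
        · exact absurd h.1 hxy.ne'
        · exact h.2
      omega
    -- The edge `xy` adds 2 to the degree sum. If both ends are complete to `A`, then `A` is
    -- `K_{r-2}`-free and loses an edge; otherwise an edge to `A` is missing.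
    by_cases hcomp : degIn G x A = A.card ∧ degIn G y A = A.card
    · have hall : ∀ z, degIn G z A = A.card → ∀ a ∈ A, G.Adj z a := by
        intro z hz a ha
        classical
        have := Finset.eq_of_subset_of_card_le (Finset.filter_subset (G.Adj z) A) hz.ge
        rw [← this, Finset.mem_filter] at ha
        exact ha.2
      have hA2 : ∀ K ⊆ A, ¬ G.IsNClique (r - 2) K := by
        intro K hKA hK
        have h1 := hK.insert (a := y) fun z hz => hall y hcomp.2 z (hKA hz)
        have h2 := h1.insert (a := x) fun z hz => by
          rcases Finset.mem_insert.1 hz with rfl | hz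
          · exact hxy
          · exact hall x hcomp.1 z (hKA hz)
        rw [show r - 2 + 1 + 1 = r by omega] at h2
        exact hG _ h2
      have := sum_degIn_lt_extremalNumber hA2 (by omega)
      rw [show r - 2 + 1 = r - 1 by omega] at this
      omega
    · have hlt : ∑ z ∈ D \ A, degIn G z A < A.card * (D \ A).card := by
        obtain ⟨z, hz, hz'⟩ : ∃ z ∈ D \ A, degIn G z A < A.card := by
          by_contra! h
          exact hcomp ⟨le_antisymm (degIn_le_card _ _) (h x hx),
            le_antisymm (degIn_le_card _ _) (h y hy)⟩
        have := Finset.sum_lt_sum (fun z (_ : z ∈ D \ A) => degIn_le_card (G := G) z A)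
          ⟨z, hz, hz'⟩
        rwa [Finset.sum_const, smul_eq_mul, mul_comm] at this
      omega
  · have hBB : ∑ z ∈ D \ A, degIn G z (D \ A) = 0 := by
      refine Finset.sum_eq_zero fun z hz => degIn_eq_zero.2 fun z' hz' h => ?_
      exact hedge ⟨z, hz, z', hz', h⟩
    omega

end CliqueCounting

/-! ### The upper bound. -/

section UpperBound

variable {V : Type*} {G : SimpleGraph V}

open Classical in
theorem IsLongestCycle.two_mul_degIn_le {C : List V} (hC : IsLongestCycle G C) {v : V}
    (hv : v ∉ C) : 2 * degIn G v C.toFinset ≤ C.length := by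
  rcases Nat.eq_zero_or_pos (degIn G v C.toFinset) with h0 | hpos
  · omega
  obtain ⟨y, hy⟩ := Finset.card_pos.1 hpos
  have hcard := Finset.card_erase_add_one hy
  have h3 := hC.1.2.1
  have hdef : degIn G v C.toFinset = (C.toFinset.filter (G.Adj v)).card := rfl
  rcases Finset.eq_empty_or_nonempty ((C.toFinset.filter (G.Adj v)).erase y) with h0 | hne
  · rw [h0, Finset.card_empty] at hcard
    omega
  · rw [Finset.mem_filter, List.mem_toFinset] at hy
    have := hC.two_mul_length_add_card_le (v := v) (l := []) hy.1 (by simp)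
      (by simp [hy.2]) (by simpa using hv) hne
    rw [List.length_singleton] at this
    omega

open Classical in
/-- If a vertex outside a longest cycle of length at most `2t + 1` has `t` neighbours on it, then
the non-neighbours on the cycle span at most one edge. -/
theorem IsLongestCycle.exists_only_edge {C : List V} (hC : IsLongestCycle G C) {v : V} {t : ℕ}
    (hv : v ∉ C) (hCt : C.length ≤ 2 * t + 1) (hdeg : degIn G v C.toFinset = t) :
    ∃ u w, ∀ x ∈ C.toFinset \ C.toFinset.filter (G.Adj v),
      ∀ y ∈ C.toFinset \ C.toFinset.filter (G.Adj v),
        G.Adj x y → x = u ∧ y = w ∨ x = w ∧ y = u := by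
  set A := C.toFinset.filter (G.Adj v) with hA
  set B := C.toFinset \ A with hB
  have hAt : A.card = t := hdeg
  have hmemA : ∀ {x}, x ∈ A ↔ x ∈ C ∧ G.Adj v x := by intro x; simp [hA]
  have hmemB : ∀ {x}, x ∈ B ↔ x ∈ C ∧ ¬ G.Adj v x := by
    intro x; simp only [hB, Finset.mem_sdiff, hmemA, List.mem_toFinset]; tauto
  have hBcard : B.card + t = C.length := by
    have h1 := Finset.card_sdiff_add_card_eq_card (Finset.filter_subset (G.Adj v) C.toFinset)
    rw [List.toFinset_card_of_nodup hC.1.1] at h1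
    rw [← hAt]; exact h1
  -- `τ` is the predecessor map, to which the crossing lemmas apply through the reversed cycle.
  obtain ⟨τ, hτ⟩ : ∃ τ : Equiv.Perm V, τ = C.formPerm⁻¹ := ⟨_, rfl⟩
  have hσ : ∀ x, C.reverse.formPerm x = τ x := fun x => by rw [List.formPerm_reverse, hτ]
  have hστ : ∀ x, C.formPerm (τ x) = x := fun x => by rw [hτ]; simp
  have hsucc : A.image C.formPerm ⊆ B := by
    intro x hx
    obtain ⟨a, ha, rfl⟩ := Finset.mem_image.1 hx
    rw [hmemA] at ha
    exact hmemB.2 ⟨List.formPerm_apply_mem_of_mem ha.1, hC.not_adj_formPerm hv ha.1 ha.2⟩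
  have hpred : A.image τ ⊆ B := by
    intro x hx
    obtain ⟨a, ha, rfl⟩ := Finset.mem_image.1 hx
    rw [hmemA] at ha
    have h1 := hC.reverse.not_adj_formPerm (by simpa using hv) (by simpa using ha.1) ha.2
    have h2 := List.formPerm_apply_mem_of_mem (l := C.reverse) (x := a) (by simpa using ha.1)
    rw [hσ] at h1 h2
    exact hmemB.2 ⟨by simpa using h2, h1⟩
  have hsuccI : ∀ x ∈ A.image C.formPerm, ∀ y ∈ A.image C.formPerm, ¬ G.Adj x y := by
    intro x hx y hy
    obtain ⟨a, ha, rfl⟩ := Finset.mem_image.1 hx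
    obtain ⟨b, hb, rfl⟩ := Finset.mem_image.1 hy
    rw [hmemA] at ha hb
    by_cases hab : a = b
    · rw [hab]; exact G.irrefl
    · exact hC.not_adj_formPerm_formPerm hv ha.1 hb.1 ha.2 hb.2 hab
  have hpredI : ∀ x ∈ A.image τ, ∀ y ∈ A.image τ, ¬ G.Adj x y := by
    intro x hx y hy
    obtain ⟨a, ha, rfl⟩ := Finset.mem_image.1 hx
    obtain ⟨b, hb, rfl⟩ := Finset.mem_image.1 hy
    rw [hmemA] at ha hb
    by_cases hab : a = b
    · rw [hab]; exact G.irrefl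
    · rw [← hσ, ← hσ]
      exact hC.reverse.not_adj_formPerm_formPerm (by simpa using hv) (by simpa using ha.1)
        (by simpa using hb.1) ha.2 hb.2 hab
  have hsc : (A.image C.formPerm).card = t := by
    rw [Finset.card_image_of_injective _ C.formPerm.injective, hAt]
  have hpc : (A.image τ).card = t := by
    rw [Finset.card_image_of_injective _ τ.injective, hAt]
  have hle := Finset.card_le_card hsucc
  -- The successors and the predecessors of `A` are independent `t`-sets in `B`, and `|B| ≤ t + 1`.
  -- If `|B| = t + 1`, each misses one vertex, `w` and `u` respectively, so every edge in `B` meets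
  -- both; `u` is the predecessor of `w`, hence distinct from it.
  rcases Nat.lt_or_ge t B.card with hlt | hge
  · have h1 : (B \ A.image C.formPerm).card = 1 := by
      rw [Finset.card_sdiff_of_subset hsucc]; omega
    have h2 : (B \ A.image τ).card = 1 := by
      rw [Finset.card_sdiff_of_subset hpred]; omega
    obtain ⟨w, hw⟩ := Finset.card_eq_one.1 h1
    obtain ⟨u, hu⟩ := Finset.card_eq_one.1 h2
    have hwB : w ∈ B ∧ w ∉ A.image C.formPerm := by
      rw [← Finset.mem_sdiff, hw]; simp
    have huw : τ w = u := by
      rw [← Finset.mem_singleton, ← hu, Finset.mem_sdiff, hmemB]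
      have hwC := (hmemB.1 hwB.1).1
      have hC' : τ w ∈ C := by
        rw [← List.formPerm_mem_iff_mem, hστ]; exact hwC
      refine ⟨⟨hC', fun h => hwB.2 ?_⟩, fun h => ?_⟩
      · exact Finset.mem_image.2 ⟨_, hmemA.2 ⟨hC', h⟩, hστ w⟩
      · obtain ⟨a, ha, ha'⟩ := Finset.mem_image.1 h
        rw [τ.injective ha'] at ha
        exact (hmemB.1 hwB.1).2 (hmemA.1 ha).2
    have hne : u ≠ w := by
      intro e
      have h3 : C.formPerm w = w := by
        conv_lhs => rw [← e, ← huw]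
        exact hστ w
      have := hC.1.2.1
      exact (List.formPerm_apply_mem_ne_self_iff _ hC.1.1 w (hmemB.1 hwB.1).1).2 (by omega) h3
    have hw' : ∀ x ∈ B, x ∉ A.image C.formPerm → x = w := by
      intro x hx hx'
      rw [← Finset.mem_singleton, ← hw, Finset.mem_sdiff]; exact ⟨hx, hx'⟩
    have hu' : ∀ x ∈ B, x ∉ A.image τ → x = u := by
      intro x hx hx'
      rw [← Finset.mem_singleton, ← hu, Finset.mem_sdiff]; exact ⟨hx, hx'⟩
    refine ⟨u, w, fun x hx y hy hxy => ?_⟩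
    have h3 : x = w ∨ y = w := by
      by_contra! h
      exact hsuccI x (by_contra fun h' => h.1 (hw' x hx h')) y
        (by_contra fun h' => h.2 (hw' y hy h')) hxy
    have h4 : x = u ∨ y = u := by
      by_contra! h
      exact hpredI x (by_contra fun h' => h.1 (hu' x hx h')) y
        (by_contra fun h' => h.2 (hu' y hy h')) hxy
    rcases h3 with rfl | rfl <;> rcases h4 with rfl | rfl
    · exact absurd rfl hne
    · right; simp
    · left; simp
    · exact absurd rfl hne
  · have := Finset.eq_of_subset_of_card_le hsucc (by omega)
    exact ⟨v, v, fun x hx y hy hxy => absurd hxy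
      (hsuccI x (this ▸ hx) y (this ▸ hy))⟩

theorem two_mul_card_edgeSet [Fintype V] :
    2 * G.edgeSet.ncard = ∑ v, degIn G v Finset.univ := by
  classical
  rw [← SimpleGraph.coe_edgeFinset, Set.ncard_coe_finset,
    ← SimpleGraph.sum_degrees_eq_twice_card_edges]
  refine Finset.sum_congr rfl fun v _ => ?_
  rw [degIn, ← SimpleGraph.card_neighborFinset_eq_degree, SimpleGraph.neighborFinset_eq_filter]

/-- Substituting `o = n - c` turns the claim into `2t² + c(c - 2t) ≤ n`. The last term is at most 0
for `c ≤ 2t` and equals `2t + 1` for `c = 2t + 1`. -/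
theorem quadratic_count_le {t c o n : ℕ} (hn : o + c = n) (hc : 1 ≤ c) (ht0 : 1 ≤ t)
    (ht : 2 * t * t ≤ n)
    (h : c ≤ 2 * t ∨ c = 2 * t + 1 ∧ 2 * t * t + (2 * t + 1) ≤ n) :
    2 * t * t + c * (c - 1) + (2 * t - 1) * o ≤ 2 * t * n := by
  have hcc : c * (c - 1) + c = c * c := by
    obtain ⟨d, rfl⟩ := Nat.exists_eq_add_of_le' hc
    simp; ring
  have hoo : (2 * t - 1) * o + o = 2 * t * o := by
    obtain ⟨d, hd⟩ : ∃ d, 2 * t = d + 1 := ⟨2 * t - 1, by omega⟩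
    rw [hd, Nat.add_sub_cancel, add_mul, one_mul]
  have hcn : c * c + 2 * t * t ≤ n + 2 * t * c := by
    rcases h with h | ⟨h, h'⟩
    · have := Nat.mul_le_mul_right c h
      omega
    · have : c * c = 2 * t * c + c := by rw [h]; ring
      omega
  have hexp : 2 * t * n = 2 * t * o + 2 * t * c := by rw [← hn]; ring
  omega

theorem card_edgeSet_le [Fintype V] {k r : ℕ} (h2 : IsTwoConnected G) (hG : G.CliqueFree r)
    (hcyc : ∀ l, IsCycleList G l → l.length < k) (hr : 3 ≤ r) (hrk : r ≤ (k - 1) / 2 + 1)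
    (hk : 5 ≤ k) (hn : k ^ 2 ≤ 2 * Fintype.card V) :
    G.edgeSet.ncard ≤
      SimpleGraph.extremalNumber ((k - 1) / 2) (⊤ : SimpleGraph (Fin (r - 1))) +
        (k - 1) / 2 * (Fintype.card V - (k - 1) / 2) := by
  classical
  obtain ⟨C, hC⟩ := h2.exists_isLongestCycle
  have hCk := hcyc C hC.1
  obtain ⟨t, ht⟩ : ∃ t, (k - 1) / 2 = t := ⟨_, rfl⟩
  rw [ht] at hrk ⊢
  have hCt : C.length ≤ 2 * t + 1 := by omega
  have ht2 : 2 ≤ t := by omega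
  set n := Fintype.card V with hn'
  set Cs := C.toFinset with hCs
  have hcard : Cs.card = C.length := List.toFinset_card_of_nodup hC.1.1
  set O := Finset.univ \ Cs with hO
  have hmemO : ∀ {v}, v ∈ O ↔ v ∉ C := by intro v; simp [hO, hCs]
  have hOcard : O.card + C.length = n := by
    rw [← hcard, hn', ← Finset.card_univ]
    exact Finset.card_sdiff_add_card_eq_card (Finset.subset_univ _)
  set W := O.filter (fun v => ∃ w, w ∉ C ∧ G.Adj v w) with hW
  have hWO : W ⊆ O := Finset.filter_subset _ _
  have hWcard := Finset.card_sdiff_add_card_eq_card hWO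
  have hsplit := two_mul_card_edgeSet (G := G)
  rw [sum_degIn_eq_add (Finset.subset_univ Cs), ← hO, sum_degIn_eq_add hWO] at hsplit
  have hiso : ∀ v ∈ O \ W, ∀ w ∈ O, ¬ G.Adj v w := by
    intro v hv w hw h
    rw [Finset.mem_sdiff] at hv
    exact hv.2 (Finset.mem_filter.2 ⟨hv.1, w, hmemO.1 hw, h⟩)
  have h01 : ∑ v ∈ O \ W, degIn G v W = 0 :=
    Finset.sum_eq_zero fun v hv => degIn_eq_zero.2 fun w hw => hiso v hv w (hWO hw)
  have h02 : ∑ v ∈ O \ W, degIn G v (O \ W) = 0 :=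
    Finset.sum_eq_zero fun v hv => degIn_eq_zero.2 fun w hw =>
      hiso v hv w (Finset.sdiff_subset hw)
  have hWsum := sum_degIn_outside_le h2 ht2 hC hCt W (fun v hv => by
    rw [hW, Finset.mem_filter] at hv
    exact ⟨hmemO.1 hv.1, hv.2⟩)
  rw [← hCs, Finset.sum_add_distrib, ← Finset.mul_sum] at hWsum
  have hOsum := Finset.sum_sdiff (f := fun v => degIn G v Cs) hWO
  have hdegO : ∀ v ∈ O \ W, degIn G v Cs ≤ t := by
    intro v hv
    have := hC.two_mul_degIn_le (hmemO.1 (Finset.sdiff_subset hv))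
    rw [← hCs] at this
    omega
  -- Only in the first case is the clique condition used; in the second even a complete graph on `C`
  -- is affordable.
  by_cases hex : ∃ v ∈ O \ W, degIn G v Cs = t
  · obtain ⟨v, hv, hvt⟩ := hex
    have hvC := hmemO.1 (Finset.sdiff_subset hv)
    obtain ⟨u, w, huw⟩ := hC.exists_only_edge hvC hCt hvt
    have hAt : (Cs.filter (G.Adj v)).card = t := hvt
    have hCsum := sum_degIn_le_of_one_edge (v := v) hr (by rw [hAt]; exact hrk) hG
      (Finset.filter_subset (G.Adj v) Cs) (fun x hx => (Finset.mem_filter.1 hx).2) huw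
    rw [hAt, hcard] at hCsum
    have hU0 := Finset.sum_le_card_nsmul _ _ _ hdegO
    rw [smul_eq_mul] at hU0
    have htC : t ≤ C.length := by rw [← hcard, ← hvt]; exact degIn_le_card _ _
    have h5 : (2 * t - 1) * W.card ≤ 2 * t * W.card := Nat.mul_le_mul_right _ (by omega)
    have h6 : t * (n - t) = t * (C.length - t) + t * W.card + (O \ W).card * t := by
      rw [mul_comm _ t, ← mul_add, ← mul_add]
      congr 1
      omega
    have h7 : 2 * t * W.card = 2 * (t * W.card) := by ring
    omega
  · have hdegO' : ∀ v ∈ O \ W, degIn G v Cs ≤ t - 1 := by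
      intro v hv
      have h1 := hdegO v hv
      have h3 : degIn G v Cs ≠ t := fun h => hex ⟨v, hv, h⟩
      omega
    have hU0 := Finset.sum_le_card_nsmul _ _ _ hdegO'
    rw [smul_eq_mul] at hU0
    have hCsum : ∑ v ∈ Cs, degIn G v Cs ≤ C.length * (C.length - 1) := by
      rw [← hcard, ← smul_eq_mul]
      refine Finset.sum_le_card_nsmul _ _ _ fun v hv => ?_
      rw [← Finset.card_erase_of_mem hv]
      refine Finset.card_le_card fun w hw => ?_
      simp only [Finset.mem_filter] at hw
      exact Finset.mem_erase.2 ⟨hw.2.ne', hw.1⟩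
    have h3 := hC.1.2.1
    suffices 2 * G.edgeSet.ncard ≤ 2 * (t * (n - t)) by omega
    -- A cycle of length `2t + 1` forces `k ≥ 2t + 2`, which supplies the extra room; otherwise `k ≥
    -- 2t + 1` is enough.
    have hn2 : 2 * t * t ≤ n ∧ (C.length ≤ 2 * t ∨ C.length = 2 * t + 1 ∧
        2 * t * t + (2 * t + 1) ≤ n) := by
      rcases Nat.lt_or_ge (2 * t) C.length with hlt | hge
      · have h11 := Nat.pow_le_pow_left (show 2 * t + 2 ≤ k by omega) 2
        have h12 : (2 * t + 2) ^ 2 = 2 * (2 * t * t + 4 * t + 2) := by ring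
        omega
      · have h11 := Nat.pow_le_pow_left (show 2 * t + 1 ≤ k by omega) 2
        have h12 : (2 * t + 1) ^ 2 = 2 * (2 * t * t + 2 * t) + 1 := by ring
        omega
    have hlow := quadratic_count_le hOcard (by omega) (by omega) hn2.1 hn2.2
    have htn : t ≤ n := le_trans (by rw [mul_assoc]; nlinarith) hn2.1
    have h8 : 2 * (t * (n - t)) + 2 * t * t = 2 * t * n := by
      obtain ⟨d, hd⟩ := Nat.exists_eq_add_of_le htn
      rw [hd, Nat.add_sub_cancel_left]; ring
    have h9 : (2 * t - 1) * O.card = (2 * t - 1) * W.card + (2 * t - 1) * (O \ W).card := by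
      rw [← hWcard]; ring
    have h10 : 2 * ((O \ W).card * (t - 1)) ≤ (2 * t - 1) * (O \ W).card := by
      rw [mul_comm _ (t - 1), ← mul_assoc]
      exact Nat.mul_le_mul_right _ (by omega)
    omega

end UpperBound

/-! ### Joins with an independent set. -/

section JoinGraph

variable {V W : Type*} {G : SimpleGraph V} {H : SimpleGraph W}

@[simp]
theorem graphJoin_adj_inl_inl {a b : V} :
    (graphJoin G H).Adj (Sum.inl a) (Sum.inl b) ↔ G.Adj a b := by
  simp [graphJoin]

@[simp]
theorem graphJoin_adj_inl_inr {a : V} {b : W} :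
    (graphJoin G H).Adj (Sum.inl a) (Sum.inr b) := by
  simp [graphJoin]

@[simp]
theorem graphJoin_adj_inr_inl {a : V} {b : W} :
    (graphJoin G H).Adj (Sum.inr b) (Sum.inl a) := by
  simp [graphJoin]

@[simp]
theorem graphJoin_adj_inr_inr {a b : W} :
    (graphJoin G H).Adj (Sum.inr a) (Sum.inr b) ↔ H.Adj a b := by
  simp [graphJoin]

theorem connected_of_complete_between {P : V → Prop} (h : ∀ a b, P a → ¬ P b → G.Adj a b)
    {a b : V} (ha : P a) (hb : ¬ P b) : G.Connected := by
  have hab := (h a b ha hb).reachable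
  have key : ∀ x, G.Reachable x a := by
    intro x
    by_cases hx : P x
    · exact (h x b hx hb).reachable.trans hab.symm
    · exact (h a x ha hx).reachable.symm
  have : Nonempty V := ⟨a⟩
  exact ⟨fun x y => (key x).trans (key y).symm⟩

/-- With two vertices on each side, deleting one still leaves a spanning complete bipartite graph
with both sides nonempty. -/
theorem isTwoConnected_of_complete_between [Finite V] {P : V → Prop}
    (h : ∀ a b, P a → ¬ P b → G.Adj a b) {a a' b b' : V} (ha : P a) (ha' : P a') (haa : a ≠ a')
    (hb : ¬ P b) (hb' : ¬ P b') (hbb : b ≠ b') : IsTwoConnected G := by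
  refine ⟨?_, connected_of_complete_between h ha hb, fun v => ?_⟩
  · have hne : ∀ x, P x → x ≠ b := fun x hx e => hb (e ▸ hx)
    rw [← Set.ncard_univ, ← Set.ncard_eq_three.2 ⟨a, a', b, haa, hne a ha, hne a' ha', rfl⟩]
    exact Set.ncard_le_ncard (Set.subset_univ _)
  · obtain ⟨x, hx, hxv⟩ : ∃ x, P x ∧ x ≠ v := by
      by_cases hav : a = v
      · exact ⟨a', ha', fun e => haa (hav.trans e.symm)⟩
      · exact ⟨a, ha, hav⟩
    obtain ⟨y, hy, hyv⟩ : ∃ y, ¬ P y ∧ y ≠ v := by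
      by_cases hbv : b = v
      · exact ⟨b', hb', fun e => hbb (hbv.trans e.symm)⟩
      · exact ⟨b, hb, hbv⟩
    exact connected_of_complete_between (P := fun z : ({v}ᶜ : Set V) => P z)
      (fun a b ha hb => h a b ha hb) (a := ⟨x, hxv⟩) (b := ⟨y, hyv⟩) hx hy

theorem cliqueFree_graphJoin_bot {s : ℕ} (h : G.CliqueFree s) :
    (graphJoin G (⊥ : SimpleGraph W)).CliqueFree (s + 1) := by
  intro K hK
  have hL : G.IsNClique K.toLeft.card K.toLeft := by
    refine ⟨fun a ha b hb hab => ?_, rfl⟩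
    have := hK.1 (Finset.mem_toLeft.1 ha) (Finset.mem_toLeft.1 hb) (by simpa using hab)
    simpa using this
  have hR : K.toRight.card ≤ 1 := by
    rw [Finset.card_le_one]
    intro a ha b hb
    by_contra hab
    have := hK.1 (Finset.mem_toRight.1 ha) (Finset.mem_toRight.1 hb) (by simpa using hab)
    simp at this
  have hsum := Finset.card_toLeft_add_card_toRight (u := K)
  rw [hK.2] at hsum
  exact h.mono (by omega) _ hL

/-- A cycle in the join with an independent set uses at least as many vertices of the first part as
of the independent set. -/
theorem cycleGraph_free_graphJoin_bot [Fintype V] {m : ℕ} (hm : 3 ≤ m)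
    (hV : 2 * Fintype.card V < m) :
    (SimpleGraph.cycleGraph m).Free (graphJoin G (⊥ : SimpleGraph W)) := by
  rintro ⟨f⟩
  obtain ⟨m, rfl⟩ := Nat.exists_eq_add_of_le' (show 2 ≤ m by omega)
  let L : Finset (Fin (m + 2)) := Finset.univ.filter fun i => (f i).isLeft
  let R : Finset (Fin (m + 2)) := Finset.univ.filter fun i => ¬ (f i).isLeft
  have hRL : R.card ≤ L.card := by
    refine Finset.card_le_card_of_injOn (fun i => i + 1) ?_ (fun i _ j _ h => add_right_cancel h)
    intro i hi
    have hadj : (graphJoin G (⊥ : SimpleGraph W)).Adj (f i) (f (i + 1)) :=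
      f.toHom.map_adj (SimpleGraph.cycleGraph_adj.2 (Or.inr (by simp)))
    simp only [R, L, Finset.coe_filter, Finset.mem_univ, true_and, Set.mem_ofPred_eq] at hi ⊢
    rcases h1 : f i with a | a
    · simp [h1] at hi
    · rcases h2 : f (i + 1) with b | b
      · rfl
      · rw [h1, h2] at hadj
        simp at hadj
  have hLV : L.card ≤ Fintype.card V := by
    have h1 : (L.map ⟨f, f.injective⟩) ⊆ Finset.univ.map (Function.Embedding.inl (β := W)) := by
      intro x hx
      simp only [L, Finset.mem_map, Finset.mem_filter, Finset.mem_univ, true_and,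
        Function.Embedding.coeFn_mk, Function.Embedding.inl_apply] at hx ⊢
      obtain ⟨i, hi, rfl⟩ := hx
      obtain ⟨a, ha⟩ := Sum.isLeft_iff.1 hi
      exact ⟨a, ha.symm⟩
    have := Finset.card_le_card h1
    rwa [Finset.card_map, Finset.card_map, Finset.card_univ] at this
  have hall : L.card + R.card = m + 2 := by
    rw [Finset.card_filter_add_card_filter_not, Finset.card_univ, Fintype.card_fin]
  omega

theorem ncard_edgeSet_graphJoin_bot [Fintype V] [Fintype W] [DecidableRel G.Adj] :
    (graphJoin G (⊥ : SimpleGraph W)).edgeSet.ncard =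
      G.edgeFinset.card + Fintype.card V * Fintype.card W := by
  classical
  have h := two_mul_card_edgeSet (G := graphJoin G (⊥ : SimpleGraph W))
  have hl : ∀ a : V, degIn (graphJoin G (⊥ : SimpleGraph W)) (Sum.inl a) Finset.univ =
      G.degree a + Fintype.card W := by
    intro a
    rw [← SimpleGraph.card_neighborFinset_eq_degree, SimpleGraph.neighborFinset_eq_filter]
    simp only [degIn, Finset.card_filter, Fintype.sum_sum_type, graphJoin_adj_inl_inl,
      graphJoin_adj_inl_inr]
    simp
  have hr : ∀ b : W, degIn (graphJoin G (⊥ : SimpleGraph W)) (Sum.inr b) Finset.univ =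
      Fintype.card V := by
    intro b
    simp only [degIn, Finset.card_filter, Fintype.sum_sum_type, graphJoin_adj_inr_inr,
      graphJoin_adj_inr_inl]
    simp
  rw [Fintype.sum_sum_type] at h
  simp only [hl, hr, Finset.sum_add_distrib, SimpleGraph.sum_degrees_eq_twice_card_edges,
    Finset.sum_const, Finset.card_univ, smul_eq_mul] at h
  rw [mul_comm (Fintype.card W)] at h
  omega

theorem SimpleGraph.Iso.ncard_edgeSet_eq (e : G ≃g H) : G.edgeSet.ncard = H.edgeSet.ncard := by
  rw [← Nat.card_coe_set_eq, ← Nat.card_coe_set_eq]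
  exact Nat.card_congr e.mapEdgeSet

end JoinGraph

/-! ### The extremal graph and the theorem. -/

theorem ncard_edgeSet_graphG2 (n k r : ℕ) (hr : 3 ≤ r) : (graphG2 n k r).edgeSet.ncard =
    SimpleGraph.extremalNumber ((k - 1) / 2) (⊤ : SimpleGraph (Fin (r - 1))) +
      (k - 1) / 2 * (n - (k - 1) / 2) := by
  have : Nontrivial (Fin (r - 1)) := Fin.nontrivial_iff_two_le.2 (by omega)
  have hcard : Fintype.card (Fin (r - 1)) - 1 = r - 2 := by rw [Fintype.card_fin]; omega
  rw [graphG2, ncard_edgeSet_graphJoin_bot, SimpleGraph.extremalNumber_top]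
  have hcongr : ∀ s t : ℕ, s = t → (SimpleGraph.turanGraph ((k - 1) / 2) s).edgeFinset.card =
      (SimpleGraph.turanGraph ((k - 1) / 2) t).edgeFinset.card := by
    rintro s _ rfl
    rfl
  rw [hcongr _ _ hcard, Fintype.card_fin, Fintype.card_fin]

theorem graphG2_mem_twoConnEdgeCounts (n k r : ℕ) (hr : 3 ≤ r) (hk : 5 ≤ k) (hkn : k ≤ n) :
    (graphG2 n k r).edgeSet.ncard ∈ twoConnEdgeCounts n (cliqueAndLongCycles r k) := by
  obtain ⟨e⟩ : Nonempty (Fin ((k - 1) / 2) ⊕ Fin (n - (k - 1) / 2) ≃ Fin n) :=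
    ⟨finSumFinEquiv.trans (finCongr (by omega))⟩
  have iso := SimpleGraph.Iso.map e (graphG2 n k r)
  refine ⟨(graphG2 n k r).map e, ?_, ?_, iso.ncard_edgeSet_eq.symm⟩
  · have ht : 1 < (k - 1) / 2 := by omega
    have hm : 1 < n - (k - 1) / 2 := by omega
    refine isTwoConnected_of_complete_between (P := fun v => (iso.symm v).isLeft)
      (a := iso (Sum.inl ⟨0, by omega⟩)) (a' := iso (Sum.inl ⟨1, ht⟩))
      (b := iso (Sum.inr ⟨0, by omega⟩)) (b' := iso (Sum.inr ⟨1, hm⟩)) ?_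
      (by simp) (by simp) (by simp) (by simp) (by simp) (by simp)
    intro a b ha hb
    rw [← iso.symm.map_adj_iff]
    obtain ⟨x, hx⟩ := Sum.isLeft_iff.1 ha
    obtain ⟨y, hy⟩ := Sum.isRight_iff.1 (by simpa using hb)
    rw [hx, hy, graphG2]
    exact graphJoin_adj_inl_inr
  · rintro F hF
    rw [cliqueAndLongCycles, Set.mem_insert_iff] at hF
    rw [← SimpleGraph.free_congr_right iso]
    rcases hF with rfl | ⟨m, hkm, rfl⟩
    · rw [← SimpleGraph.cliqueFree_iff_top_free, Fintype.card_fin]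
      have := cliqueFree_graphJoin_bot (W := Fin (n - (k - 1) / 2))
        (SimpleGraph.turanGraph_cliqueFree (n := (k - 1) / 2) (r := r - 2) (by omega))
      rwa [show r - 2 + 1 + 1 = r by omega] at this
    · exact cycleGraph_free_graphJoin_bot (by omega) (by rw [Fintype.card_fin]; omega)

theorem theorem5 (n k r : ℕ) (hr : 3 ≤ r) (hrk : r ≤ (k - 1) / 2 + 1) (hk : 5 ≤ k) (hkn : k ≤ n)
    (hn : (k : ℝ) ^ 2 / 2 ≤ (n : ℝ)) :
    IsGreatest (twoConnEdgeCounts n (cliqueAndLongCycles r k)) (graphG2 n k r).edgeSet.ncard ∧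
    (graphG2 n k r).edgeSet.ncard =
      SimpleGraph.extremalNumber ((k - 1) / 2) (⊤ : SimpleGraph (Fin (r - 1))) +
        (k - 1) / 2 * (n - (k - 1) / 2) := by
  refine ⟨⟨graphG2_mem_twoConnEdgeCounts n k r hr hk hkn, ?_⟩, ncard_edgeSet_graphG2 n k r hr⟩
  rintro _ ⟨G, h2, hfree, rfl⟩
  have hn' : k ^ 2 ≤ 2 * Fintype.card (Fin n) := by
    rw [Fintype.card_fin]
    have h : ((k ^ 2 : ℕ) : ℝ) ≤ ((2 * n : ℕ) : ℝ) := by push_cast; linarith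
    exact_mod_cast h
  have hclique : G.CliqueFree r := by
    have := hfree ⟨r, ⊤⟩ (Set.mem_insert _ _)
    rwa [← SimpleGraph.cliqueFree_iff_top_free, Fintype.card_fin] at this
  have hcyc : ∀ l, IsCycleList G l → l.length < k := by
    intro l hl
    by_contra! hlk
    exact hfree ⟨l.length, SimpleGraph.cycleGraph l.length⟩
      (Set.mem_insert_of_mem _ ⟨l.length, hlk, rfl⟩) hl.isContained
  have := card_edgeSet_le h2 hclique hcyc hr hrk hk hn'
  rw [ncard_edgeSet_graphG2 n k r hr]
  simpa using this
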